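/- Let $\mu$ be a positive Borel measure on $\mathbb R$ with infinite support and finite moments of all orders, and assume that $\mu$ is indeterminate, i.e. there is another positive measure $\nu\neq\mu$ on $\mathbb R$ with $\int x^n\,d\nu=\int x^n\,d\mu$ (all moments finite) for all $n\ge 0$. Let $P_n(x)=\sum_{k=0}^n b_{k,n}x^k$ ($n\ge0$) be the orthonormal polynomials of $\mu$: $\deg P_n=n$, the leading coefficient is positive and $\int P_nP_m\,d\mu=\delta_{nm}$. Put $\mathcal B=(b_{k,n})_{k,n\ge0}$ with $b_{k,n}=0$ for $k>n$, $\mathcal K=(\kappa_{j,k})_{j,k\ge0}$ with $$\kappa_{j,k}=\frac1{2\pi}\int_0^{2\pi}P_j(e^{it})P_k(e^{-it})\,dt,$$ $K(z,w)=\sum_{n=0}^\infty P_n(z)P_n(w)$ for $z,w\in\mathbb C$, and let $\mathcal A=(a_{j,k})_{j,k\ge0}$ be the matrix of its Taylor coefficients at the origin. Here $\sum_n|P_n(z)|^2<\infty$ for every $z\in\mathbb C$, $K(z,w)=\sum_{j,k=0}^\infty a_{j,k}z^jw^k$ absolutely for all $z,w\in\mathbb C$, and $$\rho_0=\frac1{2\pi}\int_0^{2\pi}K(e^{it},e^{-it})\,dt=\frac1{2\pi}\int_0^{2\pi}\sum_{k=0}^\infty|P_k(e^{it})|^2\,dt<\infty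 .$$ Then the matrix equations $$\text{(i)}\ \ \mathcal K=\mathcal B^*\mathcal B,\qquad \text{(ii)}\ \ \mathcal A=\mathcal B\mathcal B^*$$ hold, the series for the entries being absolutely convergent. The matrices $\mathcal A,\mathcal B,\mathcal K$ are the matrices, in the standard basis, of trace class operators on $\ell^2$, and $\operatorname{tr}\mathcal A=\operatorname{tr}\mathcal K=\rho_0$. Furthermore $a_{k,k}\ge 0$ for all $k\ge 0$, and the sequence $$c_k=\sqrt{a_{k,k}}=\Bigl(\sum_{n=k}^\infty|b_{k,n}|^2\Bigr)^{1/2}$$ satisfies $\lim_{k\to\infty}k\,c_k^{1/k}=0$, and $$\sum_{j,k=0}^\infty|a_{j,k}|^{\varepsilon}<\infty\quad\text{for every }\varepsilon>0 .$$ -/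

import Mathlib

open MeasureTheory Filter Topology Polynomial
open scoped Matrix InnerProductSpace ENNReal lp Nat

noncomputable section

namespace MomentProblem

/-- All moments of `μ` exist (are finite). -/
def HasMoments (μ : Measure ℝ) : Prop :=
  ∀ n : ℕ, Integrable (fun x : ℝ => x ^ n) μ

/-- `μ` is indeterminate: some other positive measure on `ℝ` has the same moments. -/
def IsIndeterminate (μ : Measure ℝ) : Prop :=
  HasMoments μ ∧ ∃ ν : Measure ℝ, ν ≠ μ ∧ HasMoments ν ∧
    ∀ n : ℕ, ∫ x, x ^ n ∂ν = ∫ x, x ^ n ∂μ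

/-- `P` is a sequence of orthonormal polynomials for `μ`: `P n` has degree `n` and positive leading
coefficient, and `∫ P n * P m ∂μ = δ_{n m}`. -/
structure IsOrthonormalPolynomials (μ : Measure ℝ) (P : ℕ → ℝ[X]) : Prop where
  degree_eq : ∀ n, (P n).degree = n
  leadingCoeff_pos : ∀ n, 0 < (P n).leadingCoeff
  orthonormal : ∀ n m, ∫ x, (P n).eval x * (P m).eval x ∂μ = if n = m then 1 else 0

/-- The orthonormal polynomials of `μ`, built by the Gram–Schmidt procedure from `1, x, x², …`
with the inner product `∫ p q dμ`. -/
def orthoPoly (μ : Measure ℝ) (n : ℕ) : ℝ[X] :=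
  let Q : ℝ[X] := X ^ n -
    ∑ k : Fin n, C (∫ x, x ^ n * (orthoPoly μ k).eval x ∂μ) * orthoPoly μ k
  C (√(∫ x, (Q.eval x) ^ 2 ∂μ))⁻¹ * Q
termination_by n
decreasing_by all_goals exact k.2

theorem HasMoments.integrable_eval {μ : Measure ℝ} (hμ : HasMoments μ) (p : ℝ[X]) :
    Integrable (fun x => p.eval x) μ := by
  simp only [eval_eq_sum_range]
  exact integrable_finsetSum _ fun i _ => (hμ i).const_mul _

theorem HasMoments.integral_sq_pos {μ : Measure ℝ} (hμ : HasMoments μ)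
    (hs : μ.support.Infinite) {p : ℝ[X]} (hp : p ≠ 0) : 0 < ∫ x, (p.eval x) ^ 2 ∂μ := by
  have hint : Integrable (fun x => (p.eval x) ^ 2) μ := by
    refine (hμ.integrable_eval (p ^ 2)).congr (.of_forall fun x => ?_)
    exact eval_pow _
  refine lt_of_le_of_ne (integral_nonneg fun x => sq_nonneg _) fun h0 => hs ?_
  have h1 := (integral_eq_zero_iff_of_nonneg (fun x => sq_nonneg _) hint).1 h0.symm
  have hcl : IsClosed {x | p.eval x = 0} := isClosed_eq p.continuous continuous_const
  have hae : {x | p.eval x = 0} ∈ ae μ := by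
    filter_upwards [h1] with x hx
    simpa using hx
  refine Set.Finite.subset (p.roots.toFinset.finite_toSet)
    ((Measure.support_subset_of_isClosed hcl hae).trans ?_)
  intro x hx
  simpa [hp] using hx

/-- For a measure with finite moments and infinite support the construction `orthoPoly` does give
the orthonormal polynomials. -/
theorem isOrthonormalPolynomials_orthoPoly {μ : Measure ℝ} (hμ : HasMoments μ)
    (hs : μ.support.Infinite) : IsOrthonormalPolynomials μ (orthoPoly μ) := by
  have key : ∀ n, (orthoPoly μ n).degree = (n : WithBot ℕ) ∧ 0 < (orthoPoly μ n).leadingCoeff ∧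
      ∀ m ≤ n, ∫ x, (orthoPoly μ n).eval x * (orthoPoly μ m).eval x ∂μ
        = if n = m then 1 else 0 := by
    intro n
    induction n using Nat.strong_induction_on with
    | _ n ih =>
      obtain ⟨S, hS⟩ : ∃ S : ℝ[X], S =
        ∑ k : Fin n, C (∫ x, x ^ n * (orthoPoly μ k).eval x ∂μ) * orthoPoly μ k := ⟨_, rfl⟩
      have hP : orthoPoly μ n = C (√(∫ x, ((X ^ n - S).eval x) ^ 2 ∂μ))⁻¹ * (X ^ n - S) := by
        rw [orthoPoly, hS]
      have hSdeg : S.degree < (n : WithBot ℕ) := by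
        rw [hS, ← mem_degreeLT]
        refine Submodule.sum_mem _ fun k _ => ?_
        rw [← smul_eq_C_mul]
        refine Submodule.smul_mem _ _ ?_
        rw [mem_degreeLT, (ih k k.2).1]
        exact_mod_cast k.2
      have hmon : (X ^ n - S).Monic := monic_X_pow_sub hSdeg
      have hdeg : (X ^ n - S).degree = (n : WithBot ℕ) := by
        rw [degree_sub_eq_left_of_degree_lt (by rwa [degree_X_pow]), degree_X_pow]
      have hpos := hμ.integral_sq_pos hs hmon.ne_zero
      obtain ⟨I, hI⟩ : ∃ I, I = ∫ x, ((X ^ n - S).eval x) ^ 2 ∂μ := ⟨_, rfl⟩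
      rw [← hI] at hpos hP
      have hc : 0 < (√I)⁻¹ := inv_pos.2 (Real.sqrt_pos.2 hpos)
      have horth : ∀ m < n, ∫ x, (X ^ n - S).eval x * (orthoPoly μ m).eval x ∂μ = 0 := by
        intro m hm
        have e1 : ∀ x, (X ^ n - S).eval x * (orthoPoly μ m).eval x =
            x ^ n * (orthoPoly μ m).eval x - ∑ k : Fin n,
              (∫ x, x ^ n * (orthoPoly μ k).eval x ∂μ) *
                ((orthoPoly μ k).eval x * (orthoPoly μ m).eval x) := by
          intro x
          rw [hS]
          simp [eval_finsetSum, sub_mul, Finset.sum_mul, mul_assoc]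
        have i1 : Integrable (fun x => x ^ n * (orthoPoly μ m).eval x) μ := by
          refine (hμ.integrable_eval (X ^ n * orthoPoly μ m)).congr (.of_forall fun x => ?_)
          simp
        have i2 : ∀ k, Integrable
            (fun x => (orthoPoly μ k).eval x * (orthoPoly μ m).eval x) μ := fun (k : ℕ) => by
          refine (hμ.integrable_eval (orthoPoly μ k * orthoPoly μ m)).congr (.of_forall fun x => ?_)
          exact eval_mul
        have i3 : ∀ k ∈ (Finset.univ : Finset (Fin n)), Integrable (fun x =>
            (∫ x, x ^ n * (orthoPoly μ k).eval x ∂μ) *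
              ((orthoPoly μ k).eval x * (orthoPoly μ m).eval x)) μ :=
          fun k _ => (i2 k).const_mul _
        simp only [e1]
        rw [integral_sub i1 (integrable_finsetSum _ i3), integral_finsetSum _ i3]
        simp only [integral_const_mul]
        have e2 : ∀ k : Fin n, ∫ x, (orthoPoly μ k).eval x * (orthoPoly μ m).eval x ∂μ
            = if k = ⟨m, hm⟩ then 1 else 0 := by
          intro k
          simp only [Fin.ext_iff]
          rcases le_total m k with h | h
          · exact (ih k k.2).2.2 m h
          · have := (ih m hm).2.2 k h
            simp only [mul_comm, eq_comm] at this ⊢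
            exact this
        simp [e2]
      refine ⟨?_, ?_, ?_⟩
      · rw [hP, degree_C_mul hc.ne', hdeg]
      · rw [hP, leadingCoeff_mul, leadingCoeff_C, hmon.leadingCoeff, mul_one]
        exact hc
      · intro m hm
        rcases hm.eq_or_lt with rfl | hm
        · have e3 : ∀ x, (orthoPoly μ m).eval x * (orthoPoly μ m).eval x
              = I⁻¹ * ((X ^ m - S).eval x) ^ 2 := by
            intro x
            rw [hP, eval_mul, eval_C]
            have : (√I)⁻¹ * (√I)⁻¹ = I⁻¹ := by
              rw [← mul_inv, Real.mul_self_sqrt hpos.le]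
            rw [← this]; ring
          simp only [e3]
          rw [integral_const_mul, ← hI, inv_mul_cancel₀ hpos.ne']
          simp
        · have e4 : ∀ x, (orthoPoly μ n).eval x * (orthoPoly μ m).eval x
              = (√I)⁻¹ * ((X ^ n - S).eval x * (orthoPoly μ m).eval x) := by
            intro x
            rw [hP, eval_mul, eval_C]; ring
          simp only [e4]
          rw [integral_const_mul, horth m hm, if_neg hm.ne', mul_zero]
  refine ⟨fun n => (key n).1, fun n => (key n).2.1, fun n m => ?_⟩
  rcases le_total m n with h | h
  · exact (key n).2.2 m h
  · have := (key m).2.2 n h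
    simp only [mul_comm, eq_comm] at this ⊢
    exact this

/-- The value `P_n(z)` of the `n`-th orthonormal polynomial at a complex number `z`. -/
def orthoEval (μ : Measure ℝ) (n : ℕ) (z : ℂ) : ℂ := aeval z (orthoPoly μ n)

/-- The matrix `B = (b_{k,n})`, where `P_n(x) = ∑ₖ b_{k,n} xᵏ`. -/
def matB (μ : Measure ℝ) : Matrix ℕ ℕ ℂ := Matrix.of fun k n => ((orthoPoly μ n).coeff k : ℂ)

/-- The matrix `K = (κ_{j,k})`, `κ_{j,k} = (1/2π) ∫₀^{2π} P_j(e^{it}) P_k(e^{-it}) dt`. -/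
def matK (μ : Measure ℝ) : Matrix ℕ ℕ ℂ := Matrix.of fun j k =>
  (1 / (2 * Real.pi) : ℂ) * ∫ t in (0 : ℝ)..(2 * Real.pi),
    orthoEval μ j (Complex.exp (t * Complex.I)) * orthoEval μ k (Complex.exp (-(t * Complex.I)))

/-- The kernel `K(z, w) = ∑ₙ P_n(z) P_n(w)`. -/
def kernel (μ : Measure ℝ) (z w : ℂ) : ℂ := ∑' n, orthoEval μ n z * orthoEval μ n w

/-- The matrix `A = (a_{j,k})` of the Taylor coefficients of the kernel at the origin,
`a_{j,k} = ∂_z^j ∂_w^k K(0, 0) / (j! k!)`. -/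
def matA (μ : Measure ℝ) : Matrix ℕ ℕ ℂ := Matrix.of fun j k =>
  iteratedDeriv j (fun z => iteratedDeriv k (fun w => kernel μ z w) 0) 0 / ((j ! : ℂ) * (k ! : ℂ))

/-- `ρ₀ = (1/2π) ∫₀^{2π} ∑ₖ |P_k(e^{it})|² dt`. -/
def rho0 (μ : Measure ℝ) : ℝ :=
  (1 / (2 * Real.pi)) * ∫ t in (0 : ℝ)..(2 * Real.pi),
    ∑' k, ‖orthoEval μ k (Complex.exp (t * Complex.I))‖ ^ 2

/-- `c_k = √a_{k,k}`. -/
def seqC (μ : Measure ℝ) (k : ℕ) : ℝ := √(matA μ k k).re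

/-- The infinite matrix `L` is the product `M N`: every entry `∑ₙ M_{j,n} N_{n,k}` converges
(absolutely) to `L_{j,k}`. -/
def IsMatrixProduct (L M N : Matrix ℕ ℕ ℂ) : Prop :=
  ∀ j k, HasSum (fun n => M j n * N n k) (L j k)

/-- The complex Hilbert space `ℓ²` of square summable sequences indexed by `ℕ`. -/
abbrev EllTwo : Type := lp (fun _ : ℕ => ℂ) 2

/-- The standard orthonormal basis `δ_n` of `ℓ²`. -/
def delta (n : ℕ) : EllTwo := lp.single 2 n (1 : ℂ)

/-- The bounded operator `T` on `ℓ²` has the matrix `M` with respect to the standard basis. -/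
def HasMatrix (T : EllTwo →L[ℂ] EllTwo) (M : Matrix ℕ ℕ ℂ) : Prop :=
  ∀ j k, ⟪delta j, T (delta k)⟫_ℂ = M j k

/-- The absolute value `|T| = (T* T)^{1/2}` of a bounded operator on a complex Hilbert space. -/
def operatorAbs {H : Type*} [NormedAddCommGroup H] [InnerProductSpace ℂ H] [CompleteSpace H]
    (T : H →L[ℂ] H) : H →L[ℂ] H := CFC.abs T

/-- `T` is of trace class: `∑ᵢ ⟨|T| eᵢ, eᵢ⟩ < ∞` for every orthonormal basis `(eᵢ)`. -/
def IsTraceClass.{u} {H : Type u} [NormedAddCommGroup H] [InnerProductSpace ℂ H] [CompleteSpace H]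
    (T : H →L[ℂ] H) : Prop :=
  ∀ (ι : Type u) (e : HilbertBasis ι ℂ H), Summable fun i => ⟪e i, operatorAbs T (e i)⟫_ℂ

/-- `T` has trace `τ`: `∑ᵢ ⟨T eᵢ, eᵢ⟩ = τ` for every orthonormal basis `(eᵢ)`. -/
def HasTrace.{u} {H : Type u} [NormedAddCommGroup H] [InnerProductSpace ℂ H] [CompleteSpace H]
    (T : H →L[ℂ] H) (τ : ℂ) : Prop :=
  ∀ (ι : Type u) (e : HilbertBasis ι ℂ H), HasSum (fun i => ⟪e i, T (e i)⟫_ℂ) τ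

end MomentProblem

end

noncomputable section

namespace MomentProblem

/-! ### Complex polynomials in `L²` of a measure with moments -/

/-! Everything rests on one estimate: there is a square summable sequence `g` such that for every ε
> 0 there is K with |P_n(z)| ≤ K e^{ε|z|} g_n for all n and z.

Indeterminacy enters through the point i. If evaluation at i were unbounded on the polynomials in
L²(μ+ν), the closure of the polynomials would be stable under multiplication by 1/(x-i) and 1/(x+i).
It would then contain the star algebra generated by the resolvent, on which μ and ν would have equal
integrals, forcing μ = ν (`eq_of_moments_of_eval_unbounded`). Hence ∑|P_n(i)|² < ∞.

Next, (P_n(z) - P_n(i))/(z - i) is expanded in P_0, …, P_{n-1}. With q_n = ∫ P_n(x)/(x-i) dμ the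
coefficients are P_k(i) q_n - P_n(i) q_k, and ∑|q_n|² < ∞ by Bessel. For g_n = |P_n(i)| + |q_n| this
yields |P_n(z)| ≤ g_n + |z-i| g_n ∑_{k<n} g_k |P_k(z)|. A discrete Gronwall argument bounds |P_n(z)|
by g_n ∏(1 + |z-i| g_k²), and such a product has minimal exponential type (`exists_norm_aeval_le`).

Cauchy's estimate turns this into |b_{k,n}| ≤ K e^{εr} g_n / r^k. It justifies every interchange of
sums and integrals, identifies a_{j,k} with ∑_n b_{j,n} b_{k,n}, and gives c_k ≤ K' e^{εr} / r^k.
The choice r = k/ε gives k c_k^{1/k} → 0, and |a_{j,k}| ≤ c_j c_k gives the summability of all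
powers. The rows of B have norms c_k, which are summable, so B is nuclear. The operators BB* and B*B
are positive, and their common trace is the squared Hilbert–Schmidt norm of B, which is ρ₀ by
Parseval on the circle. -/

theorem HasMoments.isFiniteMeasure {μ : Measure ℝ} (hμ : HasMoments μ) : IsFiniteMeasure μ := by
  have h := hμ 0
  simp only [pow_zero] at h
  exact (integrable_const_iff_isFiniteMeasure one_ne_zero).1 h

theorem HasMoments.add {μ ν : Measure ℝ} (hμ : HasMoments μ) (hν : HasMoments ν) :
    HasMoments (μ + ν) := fun n => (hμ n).add_measure (hν n)

theorem HasMoments.integrable_eval_complex {μ : Measure ℝ} (hμ : HasMoments μ) (p : ℂ[X]) :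
    Integrable (fun x : ℝ => p.eval (x : ℂ)) μ := by
  simp only [eval_eq_sum_range]
  refine integrable_finsetSum _ fun i _ => Integrable.const_mul ?_ _
  simpa using (hμ i).ofReal (𝕜 := ℂ)

theorem continuous_eval_ofReal (p : ℂ[X]) : Continuous fun x : ℝ => p.eval (x : ℂ) :=
  p.continuous.comp Complex.continuous_ofReal

theorem eval_map_conj_ofReal (p : ℂ[X]) (x : ℝ) :
    (p.map (starRingEnd ℂ)).eval (x : ℂ) = starRingEnd ℂ (p.eval (x : ℂ)) := by
  have h := eval_map_apply (f := starRingEnd ℂ) (p := p) (x : ℂ)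
  rwa [Complex.conj_ofReal] at h

theorem ofReal_norm_sq_eval (p : ℂ[X]) (x : ℝ) :
    ((‖p.eval (x : ℂ)‖ ^ 2 : ℝ) : ℂ) = (p * p.map (starRingEnd ℂ)).eval (x : ℂ) := by
  rw [eval_mul, eval_map_conj_ofReal, Complex.mul_conj, Complex.normSq_eq_norm_sq]

theorem HasMoments.memLp_eval {μ : Measure ℝ} (hμ : HasMoments μ) (p : ℂ[X]) :
    MemLp (fun x : ℝ => p.eval (x : ℂ)) 2 μ := by
  rw [memLp_two_iff_integrable_sq_norm (continuous_eval_ofReal p).aestronglyMeasurable]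
  have h := (hμ.integrable_eval_complex (p * p.map (starRingEnd ℂ))).re
  refine h.congr (.of_forall fun x => ?_)
  simp only [← ofReal_norm_sq_eval]
  exact Complex.ofReal_re _

theorem integral_eval_eq_of_moments {μ ν : Measure ℝ} (hμ : HasMoments μ) (hν : HasMoments ν)
    (h : ∀ n : ℕ, ∫ x, x ^ n ∂ν = ∫ x, x ^ n ∂μ) (p : ℂ[X]) :
    ∫ x : ℝ, p.eval (x : ℂ) ∂ν = ∫ x : ℝ, p.eval (x : ℂ) ∂μ := by
  have key : ∀ {ρ : Measure ℝ}, HasMoments ρ → ∫ x : ℝ, p.eval (x : ℂ) ∂ρ =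
      ∑ i ∈ Finset.range (p.natDegree + 1), p.coeff i * ((∫ x, x ^ i ∂ρ : ℝ) : ℂ) := by
    intro ρ hρ
    simp only [eval_eq_sum_range]
    have hi : ∀ i, Integrable (fun x : ℝ => (x : ℂ) ^ i) ρ := fun i => by
      simpa using (hρ i).ofReal (𝕜 := ℂ)
    rw [integral_finsetSum _ fun i _ => (hi i).const_mul _]
    refine Finset.sum_congr rfl fun i _ => ?_
    rw [integral_const_mul, ← integral_complex_ofReal]
    simp
  rw [key hμ, key hν]
  simp only [h]

/-- On the real line |p|² is the polynomial p·p̄, where p̄ has the conjugate coefficients, so it is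
determined by the moments. -/
theorem integral_norm_sq_eval_eq_of_moments {μ ν : Measure ℝ} (hμ : HasMoments μ)
    (hν : HasMoments ν) (h : ∀ n : ℕ, ∫ x, x ^ n ∂ν = ∫ x, x ^ n ∂μ) (p : ℂ[X]) :
    ∫ x : ℝ, ‖p.eval (x : ℂ)‖ ^ 2 ∂ν = ∫ x : ℝ, ‖p.eval (x : ℂ)‖ ^ 2 ∂μ := by
  have := integral_eval_eq_of_moments hμ hν h (p * p.map (starRingEnd ℂ))
  simp only [← ofReal_norm_sq_eval, integral_complex_ofReal] at this
  exact_mod_cast this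

/-! ### Functions approximable by polynomials -/

/-- The continuous functions in the `L²(σ)`-closure of the polynomials. -/
def polyClosure (σ : Measure ℝ) : Set (ℝ → ℂ) :=
  {f | Continuous f ∧ ∀ ε : ℝ≥0∞, ε ≠ 0 →
    ∃ p : ℂ[X], eLpNorm (f - fun x : ℝ => p.eval (x : ℂ)) 2 σ ≤ ε}

theorem eval_mem_polyClosure (σ : Measure ℝ) (p : ℂ[X]) :
    (fun x : ℝ => p.eval (x : ℂ)) ∈ polyClosure σ :=
  ⟨continuous_eval_ofReal p, fun ε _ => ⟨p, by simp⟩⟩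

theorem add_mem_polyClosure {σ : Measure ℝ} {f g : ℝ → ℂ} (hf : f ∈ polyClosure σ)
    (hg : g ∈ polyClosure σ) : f + g ∈ polyClosure σ := by
  refine ⟨hf.1.add hg.1, fun ε hε => ?_⟩
  obtain ⟨p, hp⟩ := hf.2 (ε / 2) (by simpa using hε)
  obtain ⟨q, hq⟩ := hg.2 (ε / 2) (by simpa using hε)
  refine ⟨p + q, ?_⟩
  have e : (f + g - fun x : ℝ => (p + q).eval (x : ℂ)) =
      (f - fun x : ℝ => p.eval (x : ℂ)) + (g - fun x : ℝ => q.eval (x : ℂ)) := by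
    ext x; simp; ring
  rw [e]
  refine (eLpNorm_add_le (hf.1.sub (continuous_eval_ofReal p)).aestronglyMeasurable
    (hg.1.sub (continuous_eval_ofReal q)).aestronglyMeasurable one_le_two).trans ?_
  exact (add_le_add hp hq).trans (ENNReal.add_halves ε).le

theorem const_mul_mem_polyClosure {σ : Measure ℝ} {f : ℝ → ℂ} (c : ℂ) (hf : f ∈ polyClosure σ) :
    (fun x => c * f x) ∈ polyClosure σ := by
  refine ⟨hf.1.const_mul c, fun ε hε => ?_⟩
  -- The `+ 1` covers c = 0.
  obtain ⟨p, hp⟩ := hf.2 (ε / (‖c‖ₑ + 1)) (ENNReal.div_ne_zero.2 ⟨hε, by finiteness⟩)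
  refine ⟨C c * p, ?_⟩
  have e : ((fun x => c * f x) - fun x : ℝ => (C c * p).eval (x : ℂ)) =
      c • (f - fun x : ℝ => p.eval (x : ℂ)) := by
    ext x; simp; ring
  rw [e, eLpNorm_const_smul]
  calc ‖c‖ₑ * _ ≤ (‖c‖ₑ + 1) * (ε / (‖c‖ₑ + 1)) := by gcongr; exact le_self_add
    _ ≤ ε := ENNReal.mul_div_le

/-- If p approximates f and q is small with q(a) = 1, then p - p(a) q still approximates f and
vanishes at a. Its quotient by X - a is a polynomial, and it approximates f/(x-a) because |1/(x-a)|
≤ 1 on the real line. -/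
theorem resolvent_mul_mem_polyClosure {σ : Measure ℝ} {a : ℂ} (ha : ∀ x : ℝ, ‖((x : ℂ) - a)⁻¹‖ ≤ 1)
    (ha' : ∀ x : ℝ, (x : ℂ) - a ≠ 0)
    (h : ∀ ε : ℝ≥0∞, ε ≠ 0 → ∃ p : ℂ[X], p.eval a = 1 ∧
      eLpNorm (fun x : ℝ => p.eval (x : ℂ)) 2 σ ≤ ε)
    {f : ℝ → ℂ} (hf : f ∈ polyClosure σ) :
    (fun x : ℝ => ((x : ℂ) - a)⁻¹ * f x) ∈ polyClosure σ := by
  refine ⟨((Complex.continuous_ofReal.sub continuous_const).inv₀ ha').mul hf.1, fun ε hε => ?_⟩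
  obtain ⟨p, hp⟩ := hf.2 (ε / 2) (by simpa using hε)
  obtain ⟨q, hq1, hq⟩ := h (ε / 2 / (‖p.eval a‖ₑ + 1))
    (ENNReal.div_ne_zero.2 ⟨by simpa using hε, by finiteness⟩)
  have hroot : (p - C (p.eval a) * q).IsRoot a := by simp [hq1]
  rw [← mul_divByMonic_eq_iff_isRoot] at hroot
  refine ⟨(p - C (p.eval a) * q) /ₘ (X - C a), ?_⟩
  have hle : eLpNorm ((f - fun x : ℝ => p.eval (x : ℂ)) + p.eval a • fun x : ℝ => q.eval (x : ℂ))
      2 σ ≤ ε := by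
    refine (eLpNorm_add_le (hf.1.sub (continuous_eval_ofReal p)).aestronglyMeasurable
      ((continuous_eval_ofReal q).const_smul _).aestronglyMeasurable one_le_two).trans ?_
    rw [eLpNorm_const_smul]
    refine (add_le_add hp ?_).trans (ENNReal.add_halves ε).le
    calc ‖p.eval a‖ₑ * _ ≤ (‖p.eval a‖ₑ + 1) * (ε / 2 / (‖p.eval a‖ₑ + 1)) := by
          gcongr; exact le_self_add
      _ ≤ ε / 2 := ENNReal.mul_div_le
  refine (eLpNorm_mono fun x => ?_).trans hle
  have hx := congrArg (fun r : ℂ[X] => ((x : ℂ) - a)⁻¹ * r.eval (x : ℂ)) hroot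
  simp only [eval_mul, eval_sub, eval_X, eval_C] at hx
  rw [inv_mul_cancel_left₀ (ha' x)] at hx
  have e : ((fun x : ℝ => ((x : ℂ) - a)⁻¹ * f x) -
      fun x : ℝ => ((p - C (p.eval a) * q) /ₘ (X - C a)).eval (x : ℂ)) x =
      ((x : ℂ) - a)⁻¹ * (((f - fun x : ℝ => p.eval (x : ℂ)) +
        p.eval a • fun x : ℝ => q.eval (x : ℂ)) x) := by
    simp only [Pi.sub_apply, Pi.add_apply, Pi.smul_apply, smul_eq_mul, hx]
    ring
  rw [e, norm_mul]
  exact mul_le_of_le_one_left (norm_nonneg _) (ha x)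

/-- The difference of the two integrals annihilates polynomials, so it is at most the L¹(μ+ν)
distance from f to any polynomial. On a finite measure that is controlled by the L² distance. -/
theorem integral_eq_of_mem_polyClosure {μ ν : Measure ℝ} (hμ : HasMoments μ) (hν : HasMoments ν)
    (h : ∀ n : ℕ, ∫ x, x ^ n ∂ν = ∫ x, x ^ n ∂μ) {f : ℝ → ℂ} (hf : f ∈ polyClosure (μ + ν))
    (hfμ : Integrable f μ) (hfν : Integrable f ν) : ∫ x, f x ∂μ = ∫ x, f x ∂ν := by
  have := hμ.isFiniteMeasure
  have := hν.isFiniteMeasure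
  have key : ∀ ε : ℝ≥0∞, ε ≠ 0 →
      ‖∫ x, f x ∂μ - ∫ x, f x ∂ν‖ₑ ≤ ε * (μ + ν) Set.univ ^ (1 / 2 : ℝ) := by
    intro ε hε
    obtain ⟨p, hp⟩ := hf.2 ε hε
    have ip := hμ.integrable_eval_complex p
    have iq := hν.integrable_eval_complex p
    have e : ∫ x, f x ∂μ - ∫ x, f x ∂ν =
        ∫ x, (f x - p.eval (x : ℂ)) ∂μ - ∫ x, (f x - p.eval (x : ℂ)) ∂ν := by
      rw [integral_sub hfμ ip, integral_sub hfν iq, integral_eval_eq_of_moments hμ hν h]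
      ring
    have hm := (hf.1.sub (continuous_eval_ofReal p)).aestronglyMeasurable (μ := μ + ν)
    calc ‖∫ x, f x ∂μ - ∫ x, f x ∂ν‖ₑ
        ≤ ‖∫ x, (f x - p.eval (x : ℂ)) ∂μ‖ₑ + ‖∫ x, (f x - p.eval (x : ℂ)) ∂ν‖ₑ := by
          rw [e]; exact enorm_sub_le
      _ ≤ ∫⁻ x, ‖f x - p.eval (x : ℂ)‖ₑ ∂μ + ∫⁻ x, ‖f x - p.eval (x : ℂ)‖ₑ ∂ν :=
          add_le_add (enorm_integral_le_lintegral_enorm _) (enorm_integral_le_lintegral_enorm _)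
      _ = eLpNorm (f - fun x : ℝ => p.eval (x : ℂ)) 1 (μ + ν) := by
          rw [eLpNorm_one_eq_lintegral_enorm, lintegral_add_measure]
          rfl
      _ ≤ _ := eLpNorm_le_eLpNorm_mul_rpow_measure_univ one_le_two hm
      _ ≤ ε * (μ + ν) Set.univ ^ (1 / 2 : ℝ) := by
          refine mul_le_mul' hp (le_of_eq ?_)
          congr 1
          norm_num
  rw [← sub_eq_zero, ← enorm_eq_zero]
  have hT : (μ + ν) Set.univ ^ (1 / 2 : ℝ) ≠ ∞ :=
    ENNReal.rpow_ne_top_of_nonneg (by norm_num) (measure_ne_top _ _)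
  by_contra hne
  obtain ⟨δ, hδ, hlt⟩ := ENNReal.exists_nnreal_pos_mul_lt hT hne
  exact absurd (key δ (by simpa using hδ.ne')) (not_le.2 hlt)

/-- The function `x ↦ 1 / (x - i)` as a bounded continuous function. -/
def resolventI : BoundedContinuousFunction ℝ ℂ :=
  BoundedContinuousFunction.ofNormedAddCommGroup (fun x : ℝ => ((x : ℂ) - Complex.I)⁻¹)
    ((Complex.continuous_ofReal.sub continuous_const).inv₀ fun x h => by
      simpa using congrArg Complex.im h) 1 fun x => by
    rw [norm_inv]
    refine inv_le_one_of_one_le₀ ?_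
    simpa using Complex.abs_im_le_norm ((x : ℂ) - Complex.I)

theorem resolventI_apply (x : ℝ) : resolventI x = ((x : ℂ) - Complex.I)⁻¹ := rfl

theorem star_resolventI_apply (x : ℝ) : (star resolventI) x = ((x : ℂ) - -Complex.I)⁻¹ := by
  simp [resolventI_apply, sub_eq_add_neg]

theorem norm_resolventI_le (x : ℝ) : ‖resolventI x‖ ≤ 1 := by
  rw [resolventI_apply, norm_inv]
  refine inv_le_one_of_one_le₀ ?_
  simpa using Complex.abs_im_le_norm ((x : ℂ) - Complex.I)

theorem ofReal_sub_I_ne_zero (x : ℝ) : (x : ℂ) - Complex.I ≠ 0 := fun h => by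
  simpa using congrArg Complex.im h

theorem ofReal_sub_neg_I_ne_zero (x : ℝ) : (x : ℂ) - -Complex.I ≠ 0 := fun h => by
  simpa using congrArg Complex.im h

/-- If the point evaluations at `± i` are unbounded on the polynomials in `L²(μ + ν)`, measures
`μ` and `ν` with the same moments coincide. -/
theorem eq_of_moments_of_eval_unbounded {μ ν : Measure ℝ} (hμ : HasMoments μ) (hν : HasMoments ν)
    (h : ∀ n : ℕ, ∫ x, x ^ n ∂ν = ∫ x, x ^ n ∂μ)
    (h1 : ∀ ε : ℝ≥0∞, ε ≠ 0 → ∃ p : ℂ[X], p.eval Complex.I = 1 ∧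
      eLpNorm (fun x : ℝ => p.eval (x : ℂ)) 2 (μ + ν) ≤ ε) : μ = ν := by
  have := hμ.isFiniteMeasure
  have := hν.isFiniteMeasure
  -- Conjugating the coefficients moves the evaluation point to -i and keeps |p| unchanged on the
  -- real line.
  have h2 : ∀ ε : ℝ≥0∞, ε ≠ 0 → ∃ p : ℂ[X], p.eval (-Complex.I) = 1 ∧
      eLpNorm (fun x : ℝ => p.eval (x : ℂ)) 2 (μ + ν) ≤ ε := by
    intro ε hε
    obtain ⟨p, hp, hpε⟩ := h1 ε hε
    refine ⟨p.map (starRingEnd ℂ), ?_, ?_⟩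
    · have := eval_map_apply (f := starRingEnd ℂ) (p := p) Complex.I
      rwa [Complex.conj_I, hp, map_one] at this
    · refine (eLpNorm_mono fun x => ?_).trans hpε
      rw [eval_map_conj_ofReal, RCLike.norm_conj]
  refine ext_of_forall_mem_subalgebra_integral_eq_of_polish
    (A := StarAlgebra.adjoin ℂ {resolventI}) ?_ fun g hg => ?_
  · intro x y hxy
    refine ⟨resolventI, ⟨resolventI.toContinuousMap, ⟨resolventI,
      StarAlgebra.self_mem_adjoin_singleton ℂ _, rfl⟩, rfl⟩, fun he => hxy ?_⟩
    change resolventI x = resolventI y at he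
    simpa [resolventI_apply] using he
  -- Both g and its star are carried along so that the induction closes under `star`. Applied to f =
  -- 1, the claim puts g itself in the closure.
  · have key : (∀ f ∈ polyClosure (μ + ν), (fun x => g x * f x) ∈ polyClosure (μ + ν)) ∧
        ∀ f ∈ polyClosure (μ + ν), (fun x => (star g) x * f x) ∈ polyClosure (μ + ν) := by
      induction hg using StarAlgebra.adjoin_induction with
      | mem g hg =>
        rw [Set.mem_singleton_iff] at hg
        subst hg
        refine ⟨fun f hf => ?_, fun f hf => ?_⟩
        · exact resolvent_mul_mem_polyClosure norm_resolventI_le ofReal_sub_I_ne_zero h1 hf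
        · simp only [star_resolventI_apply]
          refine resolvent_mul_mem_polyClosure (fun x => ?_) ofReal_sub_neg_I_ne_zero h2 hf
          rw [← star_resolventI_apply]
          simpa using norm_resolventI_le x
      | algebraMap c =>
        refine ⟨fun f hf => ?_, fun f hf => ?_⟩
        · exact const_mul_mem_polyClosure c hf
        · exact const_mul_mem_polyClosure (star c) hf
      | add g g' _ _ hg hg' =>
        refine ⟨fun f hf => ?_, fun f hf => ?_⟩
        · have := add_mem_polyClosure (hg.1 f hf) (hg'.1 f hf)
          convert this using 1
          ext x
          simp [add_mul]
        · have := add_mem_polyClosure (hg.2 f hf) (hg'.2 f hf)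
          convert this using 1
          ext x
          simp [add_mul]
      | mul g g' _ _ hg hg' =>
        refine ⟨fun f hf => ?_, fun f hf => ?_⟩
        · have := hg.1 _ (hg'.1 f hf)
          convert this using 1
          ext x
          simp [mul_assoc]
        · have := hg.2 _ (hg'.2 f hf)
          convert this using 1
          ext x
          simp [mul_assoc]
      | star g _ hg => exact ⟨hg.2, by simpa only [star_star] using hg.1⟩
    have hg1 := key.1 _ (eval_mem_polyClosure _ 1)
    simp only [eval_one, mul_one] at hg1
    exact integral_eq_of_mem_polyClosure hμ hν h hg1 (g.integrable μ) (g.integrable ν)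

/-! ### A discrete Gronwall inequality -/

/-- Past some M the tail of the series is at most ε/2, and there 1 + x ≤ e^x suffices. Each of the M
remaining factors is at most (1 + a_k/δ) e^{δR}, with δ chosen so that Mδ ≤ ε/2. -/
theorem exists_prod_one_add_mul_le {a : ℕ → ℝ} (ha : ∀ n, 0 ≤ a n) (hs : Summable a)
    {ε : ℝ} (hε : 0 < ε) : ∃ K : ℝ, 0 < K ∧ ∀ R : ℝ, 0 ≤ R → ∀ n,
      ∏ k ∈ Finset.range n, (1 + R * a k) ≤ K * Real.exp (ε * R) := by
  obtain ⟨M, hM⟩ := ((tendsto_sum_nat_add a).eventually_le_const (half_pos hε)).exists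
  obtain ⟨δ, hδ⟩ : ∃ δ, δ = ε / 2 / (M + 1) := ⟨_, rfl⟩
  have hδ0 : 0 < δ := by rw [hδ]; positivity
  refine ⟨∏ k ∈ Finset.range M, (1 + a k / δ),
    Finset.prod_pos fun k _ => by have := ha k; positivity, fun R hR n => ?_⟩
  have h1 : ∏ k ∈ Finset.range n, (1 + R * a k) ≤ ∏ k ∈ Finset.range (M + n), (1 + R * a k) := by
    rw [add_comm M n, Finset.prod_range_add]
    refine le_mul_of_one_le_right (Finset.prod_nonneg fun k _ => ?_)
      (Finset.one_le_prod fun k _ => ?_)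
    · have := mul_nonneg hR (ha k); positivity
    · have := mul_nonneg hR (ha (n + k)); linarith
  have h2 : ∏ k ∈ Finset.range M, (1 + R * a k) ≤
      (∏ k ∈ Finset.range M, (1 + a k / δ)) * Real.exp (ε / 2 * R) := by
    have e1 : ∏ k ∈ Finset.range M, (1 + R * a k) ≤
        ∏ k ∈ Finset.range M, ((1 + a k / δ) * Real.exp (δ * R)) := by
      refine Finset.prod_le_prod (fun k _ => ?_) fun k _ => ?_
      · have := mul_nonneg hR (ha k); positivity
      · have x1 := Real.add_one_le_exp (δ * R)
        have x2 : 0 ≤ a k / δ := div_nonneg (ha k) hδ0.le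
        have x3 : R * a k = (δ * R) * (a k / δ) := by field_simp
        have x4 : 0 ≤ δ * R := by positivity
        rw [x3]
        nlinarith
    refine e1.trans ?_
    rw [Finset.prod_mul_distrib, Finset.prod_const, Finset.card_range, ← Real.exp_nat_mul]
    refine mul_le_mul_of_nonneg_left (Real.exp_le_exp.2 ?_)
      (Finset.prod_nonneg fun k _ => by have := ha k; positivity)
    rw [← mul_assoc]
    refine mul_le_mul_of_nonneg_right ?_ hR
    rw [hδ]
    field_simp
    linarith
  have h3 : ∏ k ∈ Finset.range n, (1 + R * a (M + k)) ≤ Real.exp (ε / 2 * R) := by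
    calc ∏ k ∈ Finset.range n, (1 + R * a (M + k))
        ≤ ∏ k ∈ Finset.range n, Real.exp (R * a (M + k)) := by
          refine Finset.prod_le_prod (fun k _ => ?_) fun k _ => ?_
          · have := mul_nonneg hR (ha (M + k)); positivity
          · rw [add_comm]; exact Real.add_one_le_exp _
      _ = Real.exp (R * ∑ k ∈ Finset.range n, a (M + k)) := by
          rw [Finset.mul_sum, Real.exp_sum]
      _ ≤ _ := by
          rw [mul_comm]
          refine Real.exp_le_exp.2 (mul_le_mul_of_nonneg_right ?_ hR)
          refine le_trans ?_ hM
          simp only [add_comm M]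
          exact ((summable_nat_add_iff M).2 hs).sum_le_tsum _ fun k _ => ha _
  refine h1.trans ?_
  rw [Finset.prod_range_add]
  calc _ ≤ ((∏ k ∈ Finset.range M, (1 + a k / δ)) * Real.exp (ε / 2 * R)) *
        Real.exp (ε / 2 * R) :=
        mul_le_mul h2 h3 (Finset.prod_nonneg fun k _ => by
          have := mul_nonneg hR (ha (M + k)); positivity)
          (mul_nonneg (Finset.prod_nonneg fun k _ => by have := ha k; positivity)
            (Real.exp_pos _).le)
    _ = _ := by
        rw [mul_assoc, ← Real.exp_add]
        congr 2
        ring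

/-- The quantities w_n = 1 + R ∑_{k<n} g_k u_k satisfy w_{n+1} ≤ (1 + R g_n²) w_n. The constant
depends on neither R nor u, which is what makes the bound uniform in z. -/
theorem exists_gronwall_bound {g : ℕ → ℝ} (hg : ∀ n, 0 ≤ g n) (hs : Summable fun n => g n ^ 2)
    {ε : ℝ} (hε : 0 < ε) : ∃ K : ℝ, 0 < K ∧ ∀ R : ℝ, 0 ≤ R → ∀ u : ℕ → ℝ,
      (∀ n, u n ≤ g n + R * (g n * ∑ k ∈ Finset.range n, g k * u k)) →
      ∀ n, u n ≤ K * Real.exp (ε * R) * g n := by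
  obtain ⟨K, hK, h⟩ := exists_prod_one_add_mul_le (fun n => sq_nonneg (g n)) hs hε
  refine ⟨K, hK, fun R hR u hu n => ?_⟩
  have hu' : ∀ n, u n ≤ g n * (1 + R * ∑ k ∈ Finset.range n, g k * u k) := fun n =>
    (hu n).trans_eq (by ring)
  have hw : ∀ n, 1 + R * ∑ k ∈ Finset.range n, g k * u k ≤
      ∏ k ∈ Finset.range n, (1 + R * g k ^ 2) := by
    intro n
    induction n with
    | zero => simp
    | succ n ih =>
      rw [Finset.sum_range_succ, Finset.prod_range_succ]
      have h1 : R * g n * u n ≤ R * g n * (g n * (1 + R * ∑ k ∈ Finset.range n, g k * u k)) :=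
        mul_le_mul_of_nonneg_left (hu' n) (mul_nonneg hR (hg n))
      have h2 : 0 ≤ 1 + R * g n ^ 2 := by positivity
      have h3 := mul_le_mul_of_nonneg_right ih h2
      linarith
  calc u n ≤ g n * (1 + R * ∑ k ∈ Finset.range n, g k * u k) := hu' n
    _ ≤ g n * (K * Real.exp (ε * R)) :=
        mul_le_mul_of_nonneg_left ((hw n).trans (h R hR n)) (hg n)
    _ = _ := mul_comm _ _

/-! ### Orthonormal polynomials over the complex numbers -/

section Ortho

variable {μ : Measure ℝ} {P : ℕ → ℝ[X]}

theorem IsOrthonormalPolynomials.integral_mul (hP : IsOrthonormalPolynomials μ P) (j k : ℕ) :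
    ∫ x : ℝ, aeval (x : ℂ) (P j) * aeval (x : ℂ) (P k) ∂μ = if j = k then 1 else 0 := by
  have h := hP.orthonormal j k
  have e : ∀ x : ℝ, aeval (x : ℂ) (P j) * aeval (x : ℂ) (P k) =
      (((P j).eval x * (P k).eval x : ℝ) : ℂ) := fun x => by
    have h1 : ∀ p : ℝ[X], aeval (x : ℂ) p = ((p.eval x : ℝ) : ℂ) := fun p =>
      aeval_algebraMap_apply_eq_algebraMap_eval x p
    rw [h1, h1]; push_cast; rfl
  simp only [e, integral_complex_ofReal, h]
  split_ifs <;> simp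

theorem HasMoments.integrable_aeval (hμ : HasMoments μ) (p : ℝ[X]) :
    Integrable (fun x : ℝ => aeval (x : ℂ) p) μ := by
  simpa only [eval_map_algebraMap] using hμ.integrable_eval_complex (p.map (algebraMap ℝ ℂ))

theorem HasMoments.integrable_eval_mul_aeval (hμ : HasMoments μ) (p : ℂ[X]) (q : ℝ[X]) :
    Integrable (fun x : ℝ => p.eval (x : ℂ) * aeval (x : ℂ) q) μ := by
  simpa only [eval_map_algebraMap, eval_mul] using
    hμ.integrable_eval_complex (p * q.map (algebraMap ℝ ℂ))

theorem conj_aeval_ofReal (p : ℝ[X]) (x : ℝ) :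
    starRingEnd ℂ (aeval (x : ℂ) p) = aeval (x : ℂ) p := by
  have h : aeval (x : ℂ) p = ((p.eval x : ℝ) : ℂ) := aeval_algebraMap_apply_eq_algebraMap_eval x p
  rw [h, Complex.conj_ofReal]

theorem IsOrthonormalPolynomials.integral_norm_sq (hP : IsOrthonormalPolynomials μ P)
    (hμ : HasMoments μ) (c : ℕ → ℂ) (N : ℕ) :
    ∫ x : ℝ, ‖∑ k ∈ Finset.range N, c k * aeval (x : ℂ) (P k)‖ ^ 2 ∂μ =
      ∑ k ∈ Finset.range N, ‖c k‖ ^ 2 := by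
  have hi : ∀ j k, Integrable (fun x : ℝ => aeval (x : ℂ) (P j) * aeval (x : ℂ) (P k)) μ :=
    fun j k => by simpa only [map_mul] using hμ.integrable_aeval (P j * P k)
  have e : ∀ x : ℝ, ((‖∑ k ∈ Finset.range N, c k * aeval (x : ℂ) (P k)‖ ^ 2 : ℝ) : ℂ) =
      ∑ j ∈ Finset.range N, ∑ k ∈ Finset.range N, (c j * starRingEnd ℂ (c k)) *
        (aeval (x : ℂ) (P j) * aeval (x : ℂ) (P k)) := by
    intro x
    rw [← Complex.normSq_eq_norm_sq, ← Complex.mul_conj, map_sum, Finset.sum_mul_sum]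
    simp only [map_mul, conj_aeval_ofReal]
    refine Finset.sum_congr rfl fun j _ => Finset.sum_congr rfl fun k _ => by ring
  have h : ((∫ x : ℝ, ‖∑ k ∈ Finset.range N, c k * aeval (x : ℂ) (P k)‖ ^ 2 ∂μ : ℝ) : ℂ) =
      ((∑ k ∈ Finset.range N, ‖c k‖ ^ 2 : ℝ) : ℂ) := by
    rw [← integral_complex_ofReal]
    simp only [e]
    rw [integral_finsetSum _ fun j _ => integrable_finsetSum _ fun k _ => (hi j k).const_mul _]
    rw [Complex.ofReal_sum]
    refine Finset.sum_congr rfl fun j hj => ?_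
    rw [integral_finsetSum _ fun k _ => (hi j k).const_mul _]
    simp only [integral_const_mul, hP.integral_mul, mul_ite, mul_one, mul_zero]
    rw [Finset.sum_ite_eq, if_pos hj, Complex.mul_conj, Complex.normSq_eq_norm_sq]
  exact_mod_cast h

/-- Expansion of a polynomial of degree `< N` in the first `N` orthonormal polynomials. -/
theorem IsOrthonormalPolynomials.expansion (hP : IsOrthonormalPolynomials μ P)
    (hμ : HasMoments μ) {N : ℕ} {p : ℂ[X]} (hp : p.degree < N) :
    p = ∑ k ∈ Finset.range N, C (∫ x : ℝ, p.eval (x : ℂ) * aeval (x : ℂ) (P k) ∂μ) *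
      (P k).map (algebraMap ℝ ℂ) := by
  let S : Polynomial.Sequence ℂ := ⟨fun k => (P k).map (algebraMap ℝ ℂ), fun k => by
    rw [degree_map_eq_of_injective (algebraMap ℝ ℂ).injective, hP.degree_eq]⟩
  have hS : p ∈ Submodule.span ℂ (S '' Set.Iio N) := by
    rw [S.span_degreeLT fun i _ => isUnit_iff_ne_zero.2 (leadingCoeff_ne_zero.2 (S.ne_zero i))]
    exact mem_degreeLT.2 hp
  clear hp
  induction hS using Submodule.span_induction with
  | mem x hx =>
    obtain ⟨m, hm, rfl⟩ := hx
    change (P m).map (algebraMap ℝ ℂ) = ∑ k ∈ Finset.range N,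
      C (∫ x : ℝ, ((P m).map (algebraMap ℝ ℂ)).eval (x : ℂ) * aeval (x : ℂ) (P k) ∂μ) *
      (P k).map (algebraMap ℝ ℂ)
    simp only [eval_map_algebraMap, hP.integral_mul]
    have hm' : m ∈ Finset.range N := Finset.mem_range.2 hm
    rw [Finset.sum_eq_single_of_mem m hm' fun k _ hk => by simp [hk.symm]]
    simp
  | zero => simp
  | add p q _ _ hp hq =>
    conv_lhs => rw [hp, hq]
    rw [← Finset.sum_add_distrib]
    refine Finset.sum_congr rfl fun k _ => ?_
    simp only [eval_add, add_mul]
    rw [integral_add (hμ.integrable_eval_mul_aeval p _) (hμ.integrable_eval_mul_aeval q _), C_add,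
      add_mul]
  | smul c p _ hp =>
    conv_lhs => rw [hp]
    rw [Finset.smul_sum]
    refine Finset.sum_congr rfl fun k _ => ?_
    simp only [eval_smul, smul_eq_mul, mul_assoc]
    rw [integral_const_mul, C_mul, smul_eq_C_mul, mul_assoc]

theorem IsOrthonormalPolynomials.integral_mul_eq_zero (hP : IsOrthonormalPolynomials μ P)
    (hμ : HasMoments μ) {n : ℕ} {p : ℂ[X]} (hp : p.degree < n) :
    ∫ x : ℝ, p.eval (x : ℂ) * aeval (x : ℂ) (P n) ∂μ = 0 := by
  have h := hP.expansion hμ hp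
  have e : ∀ x : ℝ, p.eval (x : ℂ) * aeval (x : ℂ) (P n) = ∑ k ∈ Finset.range n,
      (∫ x : ℝ, p.eval (x : ℂ) * aeval (x : ℂ) (P k) ∂μ) *
        (aeval (x : ℂ) (P k) * aeval (x : ℂ) (P n)) := by
    intro x
    conv_lhs => rw [h]
    simp only [eval_finsetSum, eval_mul, eval_C, eval_map_algebraMap, Finset.sum_mul, mul_assoc]
  have hi : ∀ j k, Integrable (fun x : ℝ => aeval (x : ℂ) (P j) * aeval (x : ℂ) (P k)) μ :=
    fun j k => by simpa only [map_mul] using hμ.integrable_aeval (P j * P k)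
  simp only [e]
  rw [integral_finsetSum _ fun k _ => (hi k n).const_mul _]
  refine Finset.sum_eq_zero fun k hk => ?_
  rw [integral_const_mul, hP.integral_mul, if_neg (Finset.mem_range.1 hk).ne, mul_zero]

/-- The Fourier coefficients of `x ↦ 1 / (x - i)` with respect to the orthonormal polynomials. -/
def resolventCoeff (μ : Measure ℝ) (P : ℕ → ℝ[X]) (n : ℕ) : ℂ :=
  ∫ x : ℝ, resolventI x * aeval (x : ℂ) (P n) ∂μ

/-- Bessel's inequality for the Fourier coefficients of the resolvent. -/
theorem IsOrthonormalPolynomials.summable_resolventCoeff (hP : IsOrthonormalPolynomials μ P)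
    (hμ : HasMoments μ) : Summable fun n => ‖resolventCoeff μ P n‖ ^ 2 := by
  have := hμ.isFiniteMeasure
  have hm : ∀ n, MemLp (fun x : ℝ => aeval (x : ℂ) (P n)) 2 μ := fun n => by
    simpa only [eval_map_algebraMap] using hμ.memLp_eval ((P n).map (algebraMap ℝ ℂ))
  have hf : MemLp resolventI 2 μ :=
    MemLp.of_bound resolventI.continuous.aestronglyMeasurable 1 (.of_forall norm_resolventI_le)
  let v : ℕ → Lp ℂ 2 μ := fun n => (hm n).toLp _
  have hv : Orthonormal ℂ v := by
    rw [orthonormal_iff_ite]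
    intro j k
    rw [L2.inner_def, ← hP.integral_mul j k]
    refine integral_congr_ae ?_
    filter_upwards [(hm j).coeFn_toLp, (hm k).coeFn_toLp] with x h1 h2
    rw [h1, h2, RCLike.inner_apply, conj_aeval_ofReal, mul_comm]
  refine (hv.inner_products_summable (x := hf.toLp _)).congr fun n => ?_
  congr 2
  rw [L2.inner_def]
  refine integral_congr_ae ?_
  filter_upwards [(hm n).coeFn_toLp, hf.coeFn_toLp] with x h1 h2
  rw [h1, h2, RCLike.inner_apply, conj_aeval_ofReal]

/-! ### Comparison with the values at `i`, and minimal exponential type -/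

theorem HasMoments.integrable_resolventI_mul (hμ : HasMoments μ) (p : ℝ[X]) :
    Integrable (fun x : ℝ => resolventI x * aeval (x : ℂ) p) μ :=
  (hμ.integrable_aeval p).bdd_mul resolventI.continuous.aestronglyMeasurable
    (.of_forall norm_resolventI_le)

/-- The difference quotient `(p(x) - p(i)) / (x - i)` of a polynomial at `i`. -/
def diffQuot (p : ℝ[X]) : ℂ[X] :=
  (p.map (algebraMap ℝ ℂ) - C (aeval Complex.I p)) /ₘ (X - C Complex.I)

theorem sub_mul_eval_diffQuot (p : ℝ[X]) (z : ℂ) :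
    (z - Complex.I) * (diffQuot p).eval z = aeval z p - aeval Complex.I p := by
  have hroot : (p.map (algebraMap ℝ ℂ) - C (aeval Complex.I p)).IsRoot Complex.I := by simp
  rw [← mul_divByMonic_eq_iff_isRoot] at hroot
  have := congrArg (eval z) hroot
  simpa [diffQuot] using this

theorem degree_diffQuot_lt {p : ℝ[X]} {n : ℕ} (hp : p.degree = n) : (diffQuot p).degree < n := by
  rw [diffQuot]
  by_cases h : p.map (algebraMap ℝ ℂ) - C (aeval Complex.I p) = 0
  · rw [h]
    simp
  · refine (degree_divByMonic_lt _ (X - C Complex.I) h (by rw [degree_X_sub_C]; exact zero_lt_one)).trans_le ?_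
    refine (degree_sub_le _ _).trans (max_le ?_ (degree_C_le.trans ?_))
    · rw [degree_map_eq_of_injective (algebraMap ℝ ℂ).injective, hp]
    · exact_mod_cast n.zero_le

theorem eval_diffQuot_ofReal (p : ℝ[X]) (x : ℝ) :
    (diffQuot p).eval (x : ℂ) = resolventI x * (aeval (x : ℂ) p - aeval Complex.I p) := by
  rw [← sub_mul_eval_diffQuot, resolventI_apply, inv_mul_cancel_left₀ (ofReal_sub_I_ne_zero x)]

theorem integral_diffQuot_mul (hμ : HasMoments μ) (p q : ℝ[X]) :
    ∫ x : ℝ, (diffQuot p).eval (x : ℂ) * aeval (x : ℂ) q ∂μ =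
      ∫ x : ℝ, resolventI x * aeval (x : ℂ) (p * q) ∂μ -
        aeval Complex.I p * ∫ x : ℝ, resolventI x * aeval (x : ℂ) q ∂μ := by
  rw [← integral_const_mul, ← integral_sub (hμ.integrable_resolventI_mul _)
    ((hμ.integrable_resolventI_mul q).const_mul _)]
  refine integral_congr_ae (.of_forall fun x => ?_)
  simp only [eval_diffQuot_ofReal, map_mul]
  ring

/-- The comparison of the orthonormal polynomials at `z` and at `i`. -/
theorem IsOrthonormalPolynomials.aeval_eq (hP : IsOrthonormalPolynomials μ P)
    (hμ : HasMoments μ) (n : ℕ) (z : ℂ) :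
    aeval z (P n) = aeval Complex.I (P n) + (z - Complex.I) * ∑ k ∈ Finset.range n,
      (aeval Complex.I (P k) * resolventCoeff μ P n -
        aeval Complex.I (P n) * resolventCoeff μ P k) * aeval z (P k) := by
  have h := congrArg (eval z) (hP.expansion hμ (degree_diffQuot_lt (hP.degree_eq n)))
  rw [eval_finsetSum] at h
  have h1 : ∀ k ∈ Finset.range n, eval z (C (∫ x : ℝ, (diffQuot (P n)).eval (x : ℂ) *
      aeval (x : ℂ) (P k) ∂μ) * (P k).map (algebraMap ℝ ℂ)) =
      (aeval Complex.I (P k) * resolventCoeff μ P n -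
        aeval Complex.I (P n) * resolventCoeff μ P k) * aeval z (P k) := by
    intro k hk
    rw [eval_mul, eval_C, eval_map_algebraMap, integral_diffQuot_mul hμ]
    -- For k < n the difference quotient of P_k is orthogonal to P_n. This evaluates ∫ P_k P_n/(x-i)
    -- dμ as P_k(i) q_n.
    have h0 := hP.integral_mul_eq_zero hμ ((degree_diffQuot_lt (hP.degree_eq k)).trans
      (by exact_mod_cast Finset.mem_range.1 hk : ((k : ℕ) : WithBot ℕ) < n))
    rw [integral_diffQuot_mul hμ, sub_eq_zero] at h0
    rw [mul_comm (P n), h0]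
    rfl
  rw [Finset.sum_congr rfl h1] at h
  rw [← h, sub_mul_eval_diffQuot]
  ring

/-- If the series diverged, the polynomials q below would satisfy q(i) = 1 with arbitrarily small
norm in L²(μ+ν), and the two measures would coincide. -/
theorem summable_norm_sq_aeval_I (hP : IsOrthonormalPolynomials μ P) (hμ : IsIndeterminate μ) :
    Summable fun n => ‖aeval Complex.I (P n)‖ ^ 2 := by
  obtain ⟨hμ, ν, hne, hν, hmom⟩ := hμ
  by_contra hs
  refine hne (eq_of_moments_of_eval_unbounded hμ hν hmom fun ε hε => ?_).symm
  have ht := (not_summable_iff_tendsto_nat_atTop_of_nonneg fun n => sq_nonneg _).1 hs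
  have ht2 : Tendsto (fun N : ℕ => ENNReal.ofReal
      ((2 * (∑ k ∈ Finset.range N, ‖aeval Complex.I (P k)‖ ^ 2)⁻¹) ^ (2⁻¹ : ℝ))) atTop (𝓝 0) := by
    have h1 := (ht.inv_tendsto_atTop.const_mul 2).rpow_const (p := (2⁻¹ : ℝ)) (Or.inr (by norm_num))
    have h2 := ENNReal.tendsto_ofReal h1
    simpa using h2
  obtain ⟨N, hN1, hN2⟩ := ((ht2.eventually_le_const (pos_iff_ne_zero.2 hε)).and
    (ht.eventually_gt_atTop 0)).exists
  obtain ⟨S, hS⟩ : ∃ S, S = ∑ k ∈ Finset.range N, ‖aeval Complex.I (P k)‖ ^ 2 := ⟨_, rfl⟩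
  rw [← hS] at hN1 hN2
  have hSc : (S : ℂ) ≠ 0 := by exact_mod_cast hN2.ne'
  -- The extremal polynomial: among polynomials of degree < N with value 1 at i it has the least
  -- norm in L²(μ), with square 1/S. The norm in L²(μ+ν) has square 2/S because the moments agree.
  let c : ℕ → ℂ := fun k => starRingEnd ℂ (aeval Complex.I (P k)) / S
  let q : ℂ[X] := ∑ k ∈ Finset.range N, C (c k) * (P k).map (algebraMap ℝ ℂ)
  have hq : ∀ z : ℂ, q.eval z = ∑ k ∈ Finset.range N, c k * aeval z (P k) := fun z => by
    simp only [q, eval_finsetSum, eval_mul, eval_C, eval_map_algebraMap]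
  refine ⟨q, ?_, ?_⟩
  · rw [hq]
    simp only [c, div_mul_eq_mul_div]
    rw [← Finset.sum_div, div_eq_one_iff_eq hSc, hS, Complex.ofReal_sum]
    refine Finset.sum_congr rfl fun k _ => ?_
    rw [mul_comm, Complex.mul_conj, Complex.normSq_eq_norm_sq]
  · have hint : ∫ x : ℝ, ‖q.eval (x : ℂ)‖ ^ 2 ∂μ = S⁻¹ := by
      simp only [hq]
      rw [hP.integral_norm_sq hμ]
      simp only [c, norm_div, RCLike.norm_conj, div_pow]
      rw [← Finset.sum_div, ← hS, Complex.norm_real, Real.norm_of_nonneg hN2.le]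
      field_simp
    have hI : ∀ {ρ : Measure ℝ}, HasMoments ρ → Integrable (fun x : ℝ => ‖q.eval (x : ℂ)‖ ^ 2) ρ :=
      fun hρ => (memLp_two_iff_integrable_sq_norm
        (continuous_eval_ofReal q).aestronglyMeasurable).1 (hρ.memLp_eval q)
    refine le_trans (le_of_eq ?_) hN1
    rw [((hμ.add hν).memLp_eval q).eLpNorm_eq_integral_rpow_norm two_ne_zero ENNReal.ofNat_ne_top]
    simp only [ENNReal.toReal_ofNat, Real.rpow_two]
    rw [integral_add_measure (hI hμ) (hI hν),
      integral_norm_sq_eval_eq_of_moments hμ hν hmom, hint, two_mul]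

/-- The orthonormal polynomials of an indeterminate measure are of minimal exponential type,
uniformly in the degree. -/
theorem exists_norm_aeval_le (hP : IsOrthonormalPolynomials μ P) (hμ : IsIndeterminate μ) :
    ∃ g : ℕ → ℝ, (∀ n, 0 ≤ g n) ∧ (Summable fun n => g n ^ 2) ∧
      ∀ ε : ℝ, 0 < ε → ∃ K : ℝ, 0 < K ∧ ∀ (z : ℂ) n,
        ‖aeval z (P n)‖ ≤ K * Real.exp (ε * ‖z‖) * g n := by
  have h1 := summable_norm_sq_aeval_I hP hμ
  have h2 := hP.summable_resolventCoeff hμ.1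
  let g : ℕ → ℝ := fun n => ‖aeval Complex.I (P n)‖ + ‖resolventCoeff μ P n‖
  have hg : ∀ n, 0 ≤ g n := fun n => by positivity
  have hgs : Summable fun n => g n ^ 2 := by
    refine Summable.of_nonneg_of_le (fun n => sq_nonneg _) (fun n => ?_) ((h1.add h2).mul_left 2)
    exact add_sq_le
  refine ⟨g, hg, hgs, fun ε hε => ?_⟩
  obtain ⟨K, hK, h⟩ := exists_gronwall_bound hg hgs hε
  -- The factor e^ε pays for |z - i| ≤ |z| + 1.
  refine ⟨K * Real.exp ε, by positivity, fun z n => ?_⟩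
  have h3 := h ‖z - Complex.I‖ (norm_nonneg _) (fun n => ‖aeval z (P n)‖) (fun n => ?_) n
  · refine h3.trans (mul_le_mul_of_nonneg_right ?_ (hg n))
    rw [mul_assoc, ← Real.exp_add]
    refine mul_le_mul_of_nonneg_left (Real.exp_le_exp.2 ?_) hK.le
    have := norm_sub_le z Complex.I
    rw [Complex.norm_I] at this
    nlinarith
  · rw [hP.aeval_eq hμ.1 n z]
    refine (norm_add_le _ _).trans (add_le_add (le_add_of_nonneg_right (norm_nonneg _)) ?_)
    rw [norm_mul]
    refine mul_le_mul_of_nonneg_left ?_ (norm_nonneg _)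
    rw [Finset.mul_sum]
    refine (norm_sum_le _ _).trans (Finset.sum_le_sum fun k _ => ?_)
    rw [norm_mul, ← mul_assoc]
    refine mul_le_mul_of_nonneg_right ?_ (norm_nonneg _)
    refine (norm_sub_le _ _).trans ?_
    rw [norm_mul, norm_mul]
    have := norm_nonneg (aeval Complex.I (P n))
    have := norm_nonneg (aeval Complex.I (P k))
    have := norm_nonneg (resolventCoeff μ P n)
    have := norm_nonneg (resolventCoeff μ P k)
    simp only [g]
    nlinarith [mul_nonneg (norm_nonneg (aeval Complex.I (P n))) (norm_nonneg (aeval Complex.I (P k))),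
      mul_nonneg (norm_nonneg (resolventCoeff μ P n)) (norm_nonneg (resolventCoeff μ P k))]

end Ortho

/-! ### Mean values on circles -/

theorem integral_exp_pow_mul_exp_neg_pow (j k : ℕ) :
    ∫ t in (0 : ℝ)..(2 * Real.pi), Complex.exp (t * Complex.I) ^ j *
      Complex.exp (-(t * Complex.I)) ^ k = if j = k then 2 * (Real.pi : ℂ) else 0 := by
  have e : ∀ t : ℝ, Complex.exp (t * Complex.I) ^ j * Complex.exp (-(t * Complex.I)) ^ k =
      Complex.exp ((((j : ℤ) - k : ℤ) : ℂ) * Complex.I * t) := by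
    intro t
    rw [← Complex.exp_nat_mul, ← Complex.exp_nat_mul, ← Complex.exp_add]
    congr 1
    push_cast
    ring
  simp only [e]
  split_ifs with h
  · simp [h]
  · have hc : ((((j : ℤ) - k : ℤ) : ℂ) * Complex.I) ≠ 0 := by
      refine mul_ne_zero (Int.cast_ne_zero.2 ?_) Complex.I_ne_zero
      omega
    rw [integral_exp_mul_complex hc]
    have : ((((j : ℤ) - k : ℤ) : ℂ) * Complex.I) * ((2 * Real.pi : ℝ) : ℂ) =
        (((j : ℤ) - k : ℤ) : ℂ) * (2 * Real.pi * Complex.I) := by push_cast; ring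
    rw [this, Complex.exp_int_mul_two_pi_mul_I]
    simp

theorem circle_mean_aeval_mul {p q : ℝ[X]} {N : ℕ} (hp : p.natDegree < N) (hq : q.natDegree < N)
    (r : ℝ) : (1 / (2 * Real.pi) : ℂ) * ∫ t in (0 : ℝ)..(2 * Real.pi),
      aeval (r * Complex.exp (t * Complex.I)) p * aeval (r * Complex.exp (-(t * Complex.I))) q =
      ∑ k ∈ Finset.range N, (p.coeff k * q.coeff k * r ^ (2 * k) : ℂ) := by
  have e : ∀ t : ℝ, aeval (r * Complex.exp (t * Complex.I)) p *
      aeval (r * Complex.exp (-(t * Complex.I))) q =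
      ∑ j ∈ Finset.range N, ∑ k ∈ Finset.range N, (p.coeff j * q.coeff k * r ^ (j + k) : ℂ) *
        (Complex.exp (t * Complex.I) ^ j * Complex.exp (-(t * Complex.I)) ^ k) := by
    intro t
    rw [aeval_eq_sum_range' hp, aeval_eq_sum_range' hq, Finset.sum_mul_sum]
    refine Finset.sum_congr rfl fun j _ => Finset.sum_congr rfl fun k _ => ?_
    rw [Complex.real_smul, Complex.real_smul]
    ring
  have hi : ∀ j k : ℕ, IntervalIntegrable (fun t : ℝ =>
      (p.coeff j * q.coeff k * r ^ (j + k) : ℂ) *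
        (Complex.exp (t * Complex.I) ^ j * Complex.exp (-(t * Complex.I)) ^ k)) volume 0
        (2 * Real.pi) :=
    fun j k => Continuous.intervalIntegrable (by fun_prop) _ _
  simp only [e]
  rw [intervalIntegral.integral_finsetSum fun j _ => Continuous.intervalIntegrable (by fun_prop) _ _,
    Finset.mul_sum]
  refine Finset.sum_congr rfl fun j hj => ?_
  rw [intervalIntegral.integral_finsetSum fun k _ => hi j k]
  simp only [intervalIntegral.integral_const_mul, integral_exp_pow_mul_exp_neg_pow, mul_ite,
    mul_zero]
  rw [Finset.sum_ite_eq, if_pos hj, ← two_mul]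
  have : (Real.pi : ℂ) ≠ 0 := by exact_mod_cast Real.pi_ne_zero
  field_simp

theorem conj_aeval_exp (p : ℝ[X]) (t : ℝ) :
    starRingEnd ℂ (aeval (Complex.exp (t * Complex.I)) p) =
      aeval (Complex.exp (-(t * Complex.I))) p := by
  have h : starRingEnd ℂ (Complex.exp (t * Complex.I)) = Complex.exp (-(t * Complex.I)) := by
    rw [← Complex.exp_conj]; simp
  rw [← h]
  exact (aeval_conj p _).symm

theorem circle_mean_norm_sq_aeval {p : ℝ[X]} {N : ℕ} (hp : p.natDegree < N) :
    (1 / (2 * Real.pi)) * ∫ t in (0 : ℝ)..(2 * Real.pi),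
      ‖aeval (Complex.exp (t * Complex.I)) p‖ ^ 2 = ∑ k ∈ Finset.range N, p.coeff k ^ 2 := by
  have h := circle_mean_aeval_mul hp hp 1
  have e : ∀ t : ℝ, aeval (((1 : ℝ) : ℂ) * Complex.exp (t * Complex.I)) p *
      aeval (((1 : ℝ) : ℂ) * Complex.exp (-(t * Complex.I))) p =
      ((‖aeval (Complex.exp (t * Complex.I)) p‖ ^ 2 : ℝ) : ℂ) := fun t => by
    rw [Complex.ofReal_one, one_mul, one_mul, ← conj_aeval_exp, Complex.mul_conj,
      Complex.normSq_eq_norm_sq]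
  simp only [e, intervalIntegral.integral_ofReal] at h
  have h' : (((1 / (2 * Real.pi)) * ∫ t in (0 : ℝ)..(2 * Real.pi),
      ‖aeval (Complex.exp (t * Complex.I)) p‖ ^ 2 : ℝ) : ℂ) =
      ((∑ k ∈ Finset.range N, p.coeff k ^ 2 : ℝ) : ℂ) := by
    push_cast
    simpa [pow_two] using h
  exact_mod_cast h'

/-- Cauchy's estimate for the coefficients of a polynomial. -/
theorem abs_coeff_le (p : ℝ[X]) {r S : ℝ} (hr : 0 < r) (hS : ∀ z : ℂ, ‖z‖ = r → ‖aeval z p‖ ≤ S)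
    (k : ℕ) : |p.coeff k| ≤ S / r ^ k := by
  have hp : p.natDegree < max p.natDegree k + 1 := by omega
  -- Pairing p with X^k on the circle of radius r isolates the k-th coefficient.
  have hq : (X ^ k : ℝ[X]).natDegree < max p.natDegree k + 1 := by simp
  have h := circle_mean_aeval_mul hp hq r
  have hk : k ∈ Finset.range (max p.natDegree k + 1) := by simp
  rw [Finset.sum_eq_single_of_mem k hk fun j _ hj => by simp [coeff_X_pow, hj]] at h
  simp only [coeff_X_pow, if_true, Complex.ofReal_one, mul_one] at h
  have hn := congrArg norm h
  have hI : ‖∫ t in (0 : ℝ)..(2 * Real.pi), aeval (r * Complex.exp (t * Complex.I)) p *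
      aeval (r * Complex.exp (-(t * Complex.I))) (X ^ k : ℝ[X])‖ ≤
      S * r ^ k * |2 * Real.pi - 0| := by
    refine intervalIntegral.norm_integral_le_of_norm_le_const fun t _ => ?_
    rw [norm_mul]
    have e1 : ‖(r : ℂ) * Complex.exp (t * Complex.I)‖ = r := by
      rw [norm_mul, Complex.norm_exp_ofReal_mul_I, mul_one, Complex.norm_real,
        Real.norm_of_nonneg hr.le]
    have e2 : ‖aeval ((r : ℂ) * Complex.exp (-(t * Complex.I))) (X ^ k : ℝ[X])‖ = r ^ k := by
      have : -((t : ℂ) * Complex.I) = ((-t : ℝ) : ℂ) * Complex.I := by push_cast; ring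
      rw [this, map_pow, aeval_X, norm_pow, norm_mul, Complex.norm_exp_ofReal_mul_I, mul_one,
        Complex.norm_real, Real.norm_of_nonneg hr.le]
    rw [e2]
    exact mul_le_mul_of_nonneg_right (hS _ e1) (by positivity)
  rw [norm_mul, norm_mul, norm_pow, Complex.norm_real, Complex.norm_real,
    Real.norm_of_nonneg hr.le, Real.norm_eq_abs] at hn
  have hpi : ‖(1 / (2 * Real.pi) : ℂ)‖ = 1 / (2 * Real.pi) := by
    simp [abs_of_pos Real.pi_pos]
  rw [hpi] at hn
  rw [sub_zero, abs_of_pos (by positivity)] at hI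
  have h3 : |p.coeff k| * r ^ (2 * k) ≤ S * r ^ k := by
    rw [← hn, one_div, inv_mul_le_iff₀ (by positivity)]
    linarith
  rw [le_div_iff₀ (by positivity)]
  rw [two_mul, pow_add, ← mul_assoc] at h3
  exact le_of_mul_le_mul_right h3 (by positivity)

theorem kernel_exp (μ : Measure ℝ) (t : ℝ) : kernel μ (Complex.exp (t * Complex.I))
    (Complex.exp (-(t * Complex.I))) =
      ((∑' k, ‖orthoEval μ k (Complex.exp (t * Complex.I))‖ ^ 2 : ℝ) : ℂ) := by
  rw [kernel, Complex.ofReal_tsum]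
  congr 1
  ext n
  rw [orthoEval, orthoEval, ← conj_aeval_exp, Complex.mul_conj, Complex.normSq_eq_norm_sq]

theorem circle_mean_kernel (μ : Measure ℝ) :
    (1 / (2 * Real.pi) : ℂ) * (∫ t in (0 : ℝ)..(2 * Real.pi),
      kernel μ (Complex.exp (t * Complex.I)) (Complex.exp (-(t * Complex.I)))) =
        (rho0 μ : ℂ) := by
  simp only [kernel_exp, intervalIntegral.integral_ofReal, rho0]
  push_cast
  rfl

/-! ### Bounds for the values and the coefficients of the orthonormal polynomials -/

/-- The orthonormal polynomials are dominated by a square summable sequence `g` times functions of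
arbitrarily small exponential type. -/
structure IsMinimalTypeBound (μ : Measure ℝ) (g : ℕ → ℝ) : Prop where
  nonneg : ∀ n, 0 ≤ g n
  summable : Summable fun n => g n ^ 2
  natDegree_eq : ∀ n, (orthoPoly μ n).natDegree = n
  norm_orthoEval_le : ∀ ε : ℝ, 0 < ε → ∃ K : ℝ, 0 < K ∧ ∀ (z : ℂ) n,
    ‖orthoEval μ n z‖ ≤ K * Real.exp (ε * ‖z‖) * g n
  abs_coeff_le : ∀ ε : ℝ, 0 < ε → ∃ K : ℝ, 0 < K ∧ ∀ r : ℝ, 0 < r → ∀ k n,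
    |(orthoPoly μ n).coeff k| ≤ K * Real.exp (ε * r) * g n / r ^ k

/-- Infinite support and indeterminacy enter the rest of the proof only through this bound. -/
theorem exists_isMinimalTypeBound {μ : Measure ℝ} (hs : μ.support.Infinite)
    (hμ : IsIndeterminate μ) : ∃ g, IsMinimalTypeBound μ g := by
  have hP := isOrthonormalPolynomials_orthoPoly hμ.1 hs
  obtain ⟨g, hg, hgs, h⟩ := exists_norm_aeval_le hP hμ
  refine ⟨g, hg, hgs, fun n => natDegree_eq_of_degree_eq_some (hP.degree_eq n), h, fun ε hε => ?_⟩
  obtain ⟨K, hK, hb⟩ := h ε hε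
  refine ⟨K, hK, fun r hr k n => MomentProblem.abs_coeff_le _ hr (fun z hz => ?_) k⟩
  rw [← hz]
  exact hb z n

namespace IsMinimalTypeBound

variable {μ : Measure ℝ} {g : ℕ → ℝ} (h : IsMinimalTypeBound μ g)
include h

theorem coeff_eq_zero {k n : ℕ} (hkn : n < k) : (orthoPoly μ n).coeff k = 0 :=
  coeff_eq_zero_of_natDegree_lt (by rwa [h.natDegree_eq])

theorem orthoEval_eq_sum (n : ℕ) (z : ℂ) :
    orthoEval μ n z = ∑ k ∈ Finset.range (n + 1), ((orthoPoly μ n).coeff k : ℂ) * z ^ k := by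
  rw [orthoEval, aeval_eq_sum_range' (n := n + 1) (by rw [h.natDegree_eq]; omega)]
  simp only [Complex.real_smul]

theorem hasSum_orthoEval (n : ℕ) (z : ℂ) :
    HasSum (fun k => ((orthoPoly μ n).coeff k : ℂ) * z ^ k) (orthoEval μ n z) := by
  rw [h.orthoEval_eq_sum]
  refine hasSum_sum_of_ne_finset_zero fun k hk => ?_
  rw [h.coeff_eq_zero (by simpa using hk)]
  simp

theorem continuous_orthoEval (n : ℕ) : Continuous (orthoEval μ n) := by
  have : orthoEval μ n = fun z => ∑ k ∈ Finset.range (n + 1),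
      ((orthoPoly μ n).coeff k : ℂ) * z ^ k := funext fun z => h.orthoEval_eq_sum n z
  rw [this]
  fun_prop

theorem summable_norm_sq_orthoEval (z : ℂ) : Summable fun n => ‖orthoEval μ n z‖ ^ 2 := by
  obtain ⟨K, hK, hb⟩ := h.norm_orthoEval_le 1 one_pos
  refine Summable.of_nonneg_of_le (fun n => sq_nonneg _) (fun n => ?_)
    (h.summable.mul_left ((K * Real.exp (1 * ‖z‖)) ^ 2))
  rw [← mul_pow]
  exact pow_le_pow_left₀ (norm_nonneg _) (hb z n) 2

theorem matK_eq (j k : ℕ) {N : ℕ} (hj : j < N) (hk : k < N) :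
    matK μ j k = ∑ n ∈ Finset.range N,
      ((orthoPoly μ j).coeff n * (orthoPoly μ k).coeff n : ℂ) := by
  have := circle_mean_aeval_mul (p := orthoPoly μ j) (q := orthoPoly μ k) (N := N)
    (by rwa [h.natDegree_eq]) (by rwa [h.natDegree_eq]) 1
  simpa [matK, orthoEval] using this

theorem isMatrixProduct_matK : IsMatrixProduct (matK μ) (matB μ)ᴴ (matB μ) := by
  intro j k
  rw [h.matK_eq j k (N := max j k + 1) (by omega) (by omega)]
  have e : ∀ n, (matB μ)ᴴ j n * matB μ n k =
      ((orthoPoly μ j).coeff n * (orthoPoly μ k).coeff n : ℂ) := fun n => by simp [matB]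
  simp only [e]
  refine hasSum_sum_of_ne_finset_zero fun n hn => ?_
  rw [h.coeff_eq_zero (n := j) (k := n)]
  · simp
  · simp at hn; omega

/-! ### The mean of the kernel on the unit circle -/

theorem exists_norm_sq_orthoEval_exp_le : ∃ K : ℝ, ∀ (t : ℝ) n,
    ‖orthoEval μ n (Complex.exp (t * Complex.I))‖ ^ 2 ≤ K * g n ^ 2 := by
  obtain ⟨K, hK, hb⟩ := h.norm_orthoEval_le 1 one_pos
  refine ⟨(K * Real.exp 1) ^ 2, fun t n => ?_⟩
  rw [← mul_pow]
  have := hb (Complex.exp (t * Complex.I)) n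
  rw [Complex.norm_exp_ofReal_mul_I, mul_one] at this
  exact pow_le_pow_left₀ (norm_nonneg _) this 2

theorem continuous_norm_sq_orthoEval_exp (n : ℕ) :
    Continuous fun t : ℝ => ‖orthoEval μ n (Complex.exp (t * Complex.I))‖ ^ 2 :=
  ((h.continuous_orthoEval n).comp (by fun_prop)).norm.pow 2

theorem intervalIntegrable_tsum_norm_sq : IntervalIntegrable
    (fun t : ℝ => ∑' k, ‖orthoEval μ k (Complex.exp (t * Complex.I))‖ ^ 2)
    volume 0 (2 * Real.pi) := by
  obtain ⟨K, hK⟩ := h.exists_norm_sq_orthoEval_exp_le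
  refine Continuous.intervalIntegrable ?_ _ _
  refine continuous_tsum h.continuous_norm_sq_orthoEval_exp (h.summable.mul_left K)
    fun n t => ?_
  rw [Real.norm_of_nonneg (sq_nonneg _)]
  exact hK t n

/-- Termwise integration, dominated by K g_n², followed by Parseval for each P_n on the unit circle.
-/
theorem hasSum_rho0 : HasSum (fun n => ∑ k ∈ Finset.range (n + 1), (orthoPoly μ n).coeff k ^ 2)
    (rho0 μ) := by
  obtain ⟨K, hK⟩ := h.exists_norm_sq_orthoEval_exp_le
  have h1 := intervalIntegral.hasSum_integral_of_dominated_convergence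
    (μ := volume) (a := 0) (b := 2 * Real.pi)
    (F := fun n (t : ℝ) => ‖orthoEval μ n (Complex.exp (t * Complex.I))‖ ^ 2)
    (f := fun t : ℝ => ∑' k, ‖orthoEval μ k (Complex.exp (t * Complex.I))‖ ^ 2)
    (fun n _ => K * g n ^ 2)
    (fun n => (h.continuous_norm_sq_orthoEval_exp n).aestronglyMeasurable)
    (fun n => .of_forall fun t _ => by rw [Real.norm_of_nonneg (sq_nonneg _)]; exact hK t n)
    (.of_forall fun t _ => h.summable.mul_left K) intervalIntegrable_const
    (.of_forall fun t _ => (h.summable_norm_sq_orthoEval _).hasSum)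
  have h2 := h1.mul_left (1 / (2 * Real.pi))
  refine HasSum.congr_fun h2 fun n => ?_
  exact (circle_mean_norm_sq_aeval (by rw [h.natDegree_eq]; omega)).symm

/-! ### The Taylor coefficients of the kernel -/

theorem summable_coeff_mul_coeff (j k : ℕ) :
    Summable fun n => (orthoPoly μ n).coeff j * (orthoPoly μ n).coeff k := by
  obtain ⟨K, hK, hb⟩ := h.abs_coeff_le 1 one_pos
  refine Summable.of_norm_bounded (h.summable.mul_left ((K * Real.exp (1 * 1)) ^ 2)) fun n => ?_
  have hj := hb 1 one_pos j n
  have hk := hb 1 one_pos k n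
  rw [one_pow, div_one] at hj hk
  rw [Real.norm_eq_abs, abs_mul, ← mul_pow, sq]
  exact mul_le_mul hj hk (abs_nonneg _) ((abs_nonneg _).trans hj)

end IsMinimalTypeBound

/-- The entries `∑ₙ b_{j,n} b_{k,n}` of the matrix `B B*`. -/
def rowGram (μ : Measure ℝ) (j k : ℕ) : ℝ :=
  ∑' n, (orthoPoly μ n).coeff j * (orthoPoly μ n).coeff k

theorem iteratedDeriv_eq_of_hasSum {f : ℂ → ℂ} {a : ℕ → ℂ}
    (h : ∀ w, HasSum (fun k => a k * w ^ k) (f w)) (k : ℕ) :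
    iteratedDeriv k f 0 = a k * k ! := by
  have hp : HasFPowerSeriesOnBall f (FormalMultilinearSeries.ofScalars ℂ a) 0 1 := by
    refine ⟨?_, one_pos, fun {y} _ => ?_⟩
    · refine FormalMultilinearSeries.le_radius_of_summable (r := 1) _ ?_
      simpa [FormalMultilinearSeries.ofScalars_norm] using (h 1).summable.norm
    · simpa [FormalMultilinearSeries.ofScalars_apply_eq, mul_comm] using h y
  have := hp.factorial_smul 1 k
  rw [iteratedDeriv_eq_iteratedFDeriv, ← this]
  simp [mul_comm]

namespace IsMinimalTypeBound

variable {μ : Measure ℝ} {g : ℕ → ℝ} (h : IsMinimalTypeBound μ g)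
include h

theorem hasSum_rowGram (j k : ℕ) :
    HasSum (fun n => (orthoPoly μ n).coeff j * (orthoPoly μ n).coeff k) (rowGram μ j k) :=
  (h.summable_coeff_mul_coeff j k).hasSum

/-- Cauchy's estimate on the circle of radius 2ρ leaves a factor 2^{-k} for |z| ≤ ρ. -/
theorem exists_norm_coeff_mul_pow_le (ρ : ℝ) (hρ : 0 < ρ) : ∃ K : ℝ, 0 ≤ K ∧ ∀ (z : ℂ),
    ‖z‖ ≤ ρ → ∀ k n, ‖((orthoPoly μ n).coeff k : ℂ) * z ^ k‖ ≤ K * g n * (1 / 2) ^ k := by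
  obtain ⟨K, hK, hb⟩ := h.abs_coeff_le 1 one_pos
  refine ⟨K * Real.exp (1 * (2 * ρ)), by positivity, fun z hz k n => ?_⟩
  rw [norm_mul, Complex.norm_real, Real.norm_eq_abs, norm_pow]
  have h1 := hb (2 * ρ) (by positivity) k n
  refine (mul_le_mul h1 (pow_le_pow_left₀ (norm_nonneg _) hz k) (by positivity)
    ((abs_nonneg _).trans h1)).trans_eq ?_
  rw [mul_pow, one_div, inv_pow]
  field_simp

/-- The triple series over (n, j, k) is dominated by K² g_n² 2^{-j} 2^{-k}. Summing over (j, k)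
first gives the kernel, and over n first gives the Taylor series. -/
theorem hasSum_rowGram_mul_pow (z w : ℂ) :
    HasSum (fun p : ℕ × ℕ => (rowGram μ p.1 p.2 : ℂ) * z ^ p.1 * w ^ p.2) (kernel μ z w) := by
  obtain ⟨K, hK, hb⟩ := h.exists_norm_coeff_mul_pow_le (‖z‖ + ‖w‖ + 1) (by positivity)
  let F : ℕ × (ℕ × ℕ) → ℂ := fun q => (((orthoPoly μ q.1).coeff q.2.1 : ℂ) * z ^ q.2.1) *
    (((orthoPoly μ q.1).coeff q.2.2 : ℂ) * w ^ q.2.2)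
  have hgeo : Summable fun k : ℕ => (1 / 2 : ℝ) ^ k := summable_geometric_two
  have hF : Summable F := by
    have h1 := (hgeo.mul_of_nonneg hgeo (fun k => by positivity) fun k => by positivity)
    have h2 := ((h.summable.mul_left (K ^ 2)).mul_of_nonneg h1 (fun k => by positivity)
      fun p => by positivity)
    refine Summable.of_norm_bounded h2 fun q => ?_
    have hz := hb z (by linarith [norm_nonneg z, norm_nonneg w]) q.2.1 q.1
    have hw := hb w (by linarith [norm_nonneg z, norm_nonneg w]) q.2.2 q.1
    rw [norm_mul]
    refine (mul_le_mul hz hw (norm_nonneg _) ((norm_nonneg _).trans hz)).trans_eq ?_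
    ring
  have hker : ∑' q, F q = kernel μ z w := by
    have hFn : ∀ n, Summable fun p : ℕ × ℕ => (((orthoPoly μ n).coeff p.1 : ℂ) * z ^ p.1) *
        (((orthoPoly μ n).coeff p.2 : ℂ) * w ^ p.2) := fun n => hF.prod_factor n
    have h1 : ∀ n, HasSum (fun p : ℕ × ℕ => F (n, p)) (orthoEval μ n z * orthoEval μ n w) :=
      fun n => HasSum.mul (f := fun j => ((orthoPoly μ n).coeff j : ℂ) * z ^ j)
        (g := fun k => ((orthoPoly μ n).coeff k : ℂ) * w ^ k) (h.hasSum_orthoEval n z)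
        (h.hasSum_orthoEval n w) (hFn n)
    exact (hF.hasSum.prod_fiberwise h1).tsum_eq.symm
  have hF2 : HasSum (fun q : (ℕ × ℕ) × ℕ => F (q.2, q.1)) (kernel μ z w) := by
    rw [← hker]
    exact (Equiv.prodComm (ℕ × ℕ) ℕ).hasSum_iff.2 hF.hasSum
  refine hF2.prod_fiberwise fun p => ?_
  have h3 := ((Complex.hasSum_ofReal.2 (h.hasSum_rowGram p.1 p.2)).mul_right
    (z ^ p.1 * w ^ p.2))
  rw [mul_assoc]
  refine HasSum.congr_fun h3 fun n => ?_
  simp only [F]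
  push_cast
  ring

theorem matA_eq (j k : ℕ) : matA μ j k = rowGram μ j k := by
  have hz : ∀ k z, HasSum (fun j => (rowGram μ j k : ℂ) * z ^ j)
      -- Taking w = 1 in the double series makes each single column summable.
      (∑' j, (rowGram μ j k : ℂ) * z ^ j) := fun k z => by
    have h1 := ((Equiv.prodComm ℕ ℕ).hasSum_iff.2
      (h.hasSum_rowGram_mul_pow z 1)).summable.prod_factor k
    simpa using h1.hasSum
  have hw : ∀ z w, HasSum (fun k => (∑' j, (rowGram μ j k : ℂ) * z ^ j) * w ^ k)
      (kernel μ z w) := fun z w =>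
    ((Equiv.prodComm ℕ ℕ).hasSum_iff.2 (h.hasSum_rowGram_mul_pow z w)).prod_fiberwise
      fun k => (hz k z).mul_right (w ^ k)
  have h1 : (fun z => iteratedDeriv k (fun w => kernel μ z w) 0) =
      fun z => (∑' j, (rowGram μ j k : ℂ) * z ^ j) * k ! :=
    funext fun z => iteratedDeriv_eq_of_hasSum (hw z) k
  have h2 : iteratedDeriv j (fun z => (∑' j, (rowGram μ j k : ℂ) * z ^ j) * k !) 0 =
      (rowGram μ j k * k ! : ℂ) * j ! := by
    refine iteratedDeriv_eq_of_hasSum (a := fun j => (rowGram μ j k * k ! : ℂ)) (fun z => ?_) j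
    refine HasSum.congr_fun ((hz k z).mul_right (k ! : ℂ)) fun j => ?_
    ring
  rw [matA, Matrix.of_apply, h1, h2]
  have hj : (j ! : ℂ) ≠ 0 := by exact_mod_cast j.factorial_ne_zero
  have hk : (k ! : ℂ) ≠ 0 := by exact_mod_cast k.factorial_ne_zero
  field_simp

theorem isMatrixProduct_matA : IsMatrixProduct (matA μ) (matB μ) (matB μ)ᴴ := by
  intro j k
  rw [h.matA_eq]
  refine HasSum.congr_fun (Complex.hasSum_ofReal.2 (h.hasSum_rowGram j k)) fun n => ?_
  simp [matB]

end IsMinimalTypeBound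

/-! ### Hilbert–Schmidt and nuclear operators -/

section Operators

variable {H : Type*} [NormedAddCommGroup H] [InnerProductSpace ℂ H] [CompleteSpace H]

omit [CompleteSpace H] in
theorem hasSum_norm_inner_sq {ι : Type*} (e : HilbertBasis ι ℂ H) (x : H) :
    HasSum (fun i => ‖⟪e i, x⟫_ℂ‖ ^ 2) (‖x‖ ^ 2) := by
  have h := (Complex.hasSum_re (e.hasSum_inner_mul_inner x x))
  rw [inner_self_eq_norm_sq_to_K] at h
  convert h using 1
  · ext i
    rw [← inner_conj_symm x (e i), mul_comm, Complex.mul_conj, Complex.normSq_eq_norm_sq]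
    exact (Complex.ofReal_re _).symm
  · norm_cast

/-- The Hilbert–Schmidt norms of an operator and its adjoint in two bases agree. -/
theorem hasSum_norm_adjoint_sq {ι κ : Type*} (e : HilbertBasis ι ℂ H) (f : HilbertBasis κ ℂ H)
    {T : H →L[ℂ] H} {s : ℝ} (h : HasSum (fun i => ‖T (e i)‖ ^ 2) s) :
    HasSum (fun k => ‖T.adjoint (f k)‖ ^ 2) s := by
  let F : ι × κ → ℝ := fun p => ‖⟪f p.2, T (e p.1)⟫_ℂ‖ ^ 2
  have h1 : ∀ i, HasSum (fun k => F (i, k)) (‖T (e i)‖ ^ 2) := fun i =>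
    hasSum_norm_inner_sq f (T (e i))
  have hF : Summable F := by
    rw [summable_prod_of_nonneg fun p => sq_nonneg _]
    refine ⟨fun i => (h1 i).summable, ?_⟩
    exact h.summable.congr fun i => (h1 i).tsum_eq.symm
  have hs : HasSum F s := by
    rw [← (hF.hasSum.prod_fiberwise h1).unique h]
    exact hF.hasSum
  have hs2 : HasSum (fun p : κ × ι => F (p.2, p.1)) s :=
    (Equiv.prodComm κ ι).hasSum_iff.2 hs
  refine hs2.prod_fiberwise fun k => ?_
  refine HasSum.congr_fun (hasSum_norm_inner_sq e (T.adjoint (f k))) fun i => ?_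
  simp only [F]
  rw [ContinuousLinearMap.adjoint_inner_right, norm_inner_symm]

theorem operatorAbs_operatorAbs_apply (T : H →L[ℂ] H) (x : H) :
    operatorAbs T (operatorAbs T x) = T.adjoint (T x) :=
  congrArg (fun S : H →L[ℂ] H => S x) (CFC.abs_mul_abs T)

theorem norm_operatorAbs_apply (T : H →L[ℂ] H) (x : H) : ‖operatorAbs T x‖ = ‖T x‖ := by
  have hS := (ContinuousLinearMap.nonneg_iff_isPositive _).1 (CFC.abs_nonneg T)
  have h : ⟪operatorAbs T x, operatorAbs T x⟫_ℂ = ⟪T x, T x⟫_ℂ := by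
    rw [← ContinuousLinearMap.adjoint_inner_right T, ← operatorAbs_operatorAbs_apply]
    exact hS.inner_left_eq_inner_right x _
  rw [inner_self_eq_norm_sq_to_K, inner_self_eq_norm_sq_to_K] at h
  have h' : ‖operatorAbs T x‖ ^ 2 = ‖T x‖ ^ 2 := by exact_mod_cast h
  exact (pow_left_inj₀ (norm_nonneg _) (norm_nonneg _) two_ne_zero).1 h'

/-- An approximate polar decomposition: up to `δ`, the form of `|T|` is that of `W* T` for a
contraction `W`. -/
theorem exists_contraction_operatorAbs (T : H →L[ℂ] H) {δ : ℝ} (hδ : 0 < δ) :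
    ∃ W : H →L[ℂ] H, ‖W‖ ≤ 1 ∧ ∀ x, ‖⟪x, operatorAbs T x⟫_ℂ‖ ≤ ‖⟪T x, W x⟫_ℂ‖ + δ * ‖x‖ ^ 2 := by
  have hS := (ContinuousLinearMap.nonneg_iff_isPositive _).1 (CFC.abs_nonneg T)
  -- Since |T| + δ ≥ δ > 0, it has an inverse R. The contraction W = T R replaces the partial
  -- isometry of the polar decomposition.
  have hu : IsUnit (CFC.abs T + algebraMap ℝ (H →L[ℂ] H) δ) :=
    CStarAlgebra.isUnit_of_le (algebraMap ℝ (H →L[ℂ] H) δ)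
      (le_add_of_nonneg_left (CFC.abs_nonneg T)) (isStrictlyPositive_algebraMap hδ)
  obtain ⟨R, hR⟩ := hu.exists_right_inv
  have hRx : ∀ x, operatorAbs T (R x) + (δ : ℂ) • R x = x := fun x => by
    have := congrArg (fun S : H →L[ℂ] H => S x) hR
    simpa [Algebra.algebraMap_eq_smul_one, operatorAbs] using this
  have hle : ∀ x, ‖operatorAbs T (R x)‖ ≤ ‖x‖ := fun x => by
    have hpos : 0 ≤ RCLike.re ⟪operatorAbs T (R x), (δ : ℂ) • R x⟫_ℂ := by
      rw [inner_smul_right]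
      have h2 := hS.re_inner_nonneg_left (R x)
      have h3 : RCLike.re ((δ : ℂ) * ⟪operatorAbs T (R x), R x⟫_ℂ) =
          δ * RCLike.re ⟪operatorAbs T (R x), R x⟫_ℂ := Complex.re_ofReal_mul _ _
      rw [h3]
      exact mul_nonneg hδ.le h2
    -- Here x = |T|Rx + δRx, and the cross term is nonnegative because |T| ≥ 0; hence ‖|T|Rx‖ ≤ ‖x‖.
    have h1 := @norm_add_sq ℂ _ _ _ _ (operatorAbs T (R x)) ((δ : ℂ) • R x)
    rw [hRx] at h1
    refine (pow_le_pow_iff_left₀ (norm_nonneg _) (norm_nonneg _) two_ne_zero).1 ?_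
    nlinarith [sq_nonneg ‖(δ : ℂ) • R x‖]
  refine ⟨T ∘L R, ContinuousLinearMap.opNorm_le_bound _ zero_le_one fun x => ?_, fun x => ?_⟩
  · rw [one_mul, ContinuousLinearMap.comp_apply, ← norm_operatorAbs_apply]
    exact hle x
  · have e : operatorAbs T x = T.adjoint (T (R x)) + (δ : ℂ) • operatorAbs T (R x) := by
      rw [← operatorAbs_operatorAbs_apply, ← map_smul, ← map_add, hRx]
    rw [e, inner_add_right, ContinuousLinearMap.adjoint_inner_right, inner_smul_right]
    refine (norm_add_le _ _).trans (add_le_add le_rfl ?_)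
    rw [norm_mul, Complex.norm_real, Real.norm_of_nonneg hδ.le]
    refine mul_le_mul_of_nonneg_left ?_ hδ.le
    rw [sq]
    exact (norm_inner_le_norm _ _).trans (mul_le_mul_of_nonneg_left (hle x) (norm_nonneg x))

omit [CompleteSpace H] in
theorem sum_norm_inner_mul_norm_inner_le {ι : Type*} {e : ι → H} (he : Orthonormal ℂ e)
    (s : Finset ι) (x y : H) :
    ∑ i ∈ s, ‖⟪x, e i⟫_ℂ‖ * ‖⟪y, e i⟫_ℂ‖ ≤ ‖x‖ * ‖y‖ := by
  have h : ∀ x : H, ∑ i ∈ s, ‖⟪x, e i⟫_ℂ‖ ^ 2 ≤ ‖x‖ ^ 2 := fun x => by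
    simpa only [norm_inner_symm x] using he.sum_inner_products_le x (s := s)
  refine (pow_le_pow_iff_left₀ (by positivity) (by positivity) two_ne_zero).1 ?_
  refine (Finset.sum_mul_sq_le_sq_mul_sq s _ _).trans ?_
  rw [mul_pow]
  exact mul_le_mul (h x) (h y) (Finset.sum_nonneg fun i _ => sq_nonneg _) (sq_nonneg _)

/-- Nuclear operators on a Hilbert space are of trace class. -/
theorem isTraceClass_of_hasSum {κ : Type*} {T : H →L[ℂ] H} {u v : κ → H}
    (hs : Summable fun k => ‖u k‖ * ‖v k‖)
    (h : ∀ x, HasSum (fun k => ⟪v k, x⟫_ℂ • u k) (T x)) : IsTraceClass T := by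
  intro ι e
  refine Summable.of_norm ?_
  refine summable_of_sum_le (c := ∑' k, ‖u k‖ * ‖v k‖) (fun i => norm_nonneg _) fun s => ?_
  refine le_of_forall_pos_le_add fun ε hε => ?_
  -- W depends on s and ε, but the final bound does not. The choice of δ keeps the accumulated error
  -- over s below ε.
  obtain ⟨W, hW, hle⟩ := exists_contraction_operatorAbs T
    (δ := ε / (s.card + 1)) (by positivity)
  have hterm : ∀ i, Summable fun k => ‖⟪v k, e i⟫_ℂ‖ * ‖⟪W.adjoint (u k), e i⟫_ℂ‖ := fun i => by
    refine Summable.of_nonneg_of_le (fun k => by positivity) (fun k => ?_) hs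
    have h1 := norm_inner_le_norm (𝕜 := ℂ) (v k) (e i)
    have h2 := norm_inner_le_norm (𝕜 := ℂ) (u k) (W (e i))
    have h3 := W.le_of_opNorm_le hW (e i)
    rw [e.orthonormal.norm_eq_one, mul_one] at h1 h3
    rw [ContinuousLinearMap.adjoint_inner_left, mul_comm]
    exact mul_le_mul (h2.trans (mul_le_of_le_one_right (norm_nonneg _) h3)) h1 (norm_nonneg _)
      (norm_nonneg _)
  have hi : ∀ i, ‖⟪T (e i), W (e i)⟫_ℂ‖ ≤
      ∑' k, ‖⟪v k, e i⟫_ℂ‖ * ‖⟪W.adjoint (u k), e i⟫_ℂ‖ := fun i => by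
    have h1 := (h (e i)).mapL (innerSL ℂ (W (e i)))
    rw [norm_inner_symm, ← innerSL_apply_apply ℂ (W (e i)), ← h1.tsum_eq]
    have e1 : ∀ k, ‖innerSL ℂ (W (e i)) (⟪v k, e i⟫_ℂ • u k)‖ =
        ‖⟪v k, e i⟫_ℂ‖ * ‖⟪W.adjoint (u k), e i⟫_ℂ‖ := fun k => by
      rw [innerSL_apply_apply, inner_smul_right, norm_mul,
        ContinuousLinearMap.adjoint_inner_left, norm_inner_symm (W (e i))]
    refine (norm_tsum_le_tsum_norm ?_).trans_eq (tsum_congr e1)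
    exact (hterm i).congr fun k => (e1 k).symm
  calc ∑ i ∈ s, ‖⟪e i, operatorAbs T (e i)⟫_ℂ‖
      ≤ ∑ i ∈ s, (∑' k, ‖⟪v k, e i⟫_ℂ‖ * ‖⟪W.adjoint (u k), e i⟫_ℂ‖ + ε / (s.card + 1)) := by
        refine Finset.sum_le_sum fun i _ => (hle (e i)).trans (add_le_add (hi i) (le_of_eq ?_))
        rw [e.orthonormal.norm_eq_one, one_pow, mul_one]
    _ = ∑' k, ∑ i ∈ s, ‖⟪v k, e i⟫_ℂ‖ * ‖⟪W.adjoint (u k), e i⟫_ℂ‖ +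
          s.card * (ε / (s.card + 1)) := by
        rw [Finset.sum_add_distrib, Finset.sum_const, nsmul_eq_mul,
          Summable.tsum_finsetSum fun i _ => hterm i]
    _ ≤ ∑' k, ‖u k‖ * ‖v k‖ + ε := by
        refine add_le_add (Summable.tsum_le_tsum (fun k => ?_)
          (summable_sum fun i _ => hterm i) hs) ?_
        · refine (sum_norm_inner_mul_norm_inner_le e.orthonormal s _ _).trans ?_
          rw [mul_comm]
          refine mul_le_mul_of_nonneg_right ?_ (norm_nonneg _)
          refine (W.adjoint.le_of_opNorm_le (c := 1) ?_ _).trans_eq (one_mul _)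
          rwa [LinearIsometryEquiv.norm_map]
        · rw [mul_div_assoc', div_le_iff₀ (by positivity)]
          nlinarith

theorem isTraceClass_of_nonneg_of_hasTrace {T : H →L[ℂ] H} (hT : 0 ≤ T) {τ : ℂ}
    (h : HasTrace T τ) : IsTraceClass T := by
  intro ι e
  rw [operatorAbs, CFC.abs_of_nonneg T hT]
  exact (h ι e).summable

theorem adjoint_comp_self_nonneg (T : H →L[ℂ] H) : 0 ≤ T.adjoint ∘L T :=
  star_mul_self_nonneg T

/-- The diagonal entries are ‖T e_i‖². Passing from the basis f to an arbitrary basis e exchanges T*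
and T, which is why the hypothesis concerns the adjoint. -/
theorem hasTrace_adjoint_comp_self {κ : Type*} (f : HilbertBasis κ ℂ H) {T : H →L[ℂ] H} {s : ℝ}
    (h : HasSum (fun k => ‖T.adjoint (f k)‖ ^ 2) s) : HasTrace (T.adjoint ∘L T) s := by
  intro ι e
  have h1 := hasSum_norm_adjoint_sq f e h
  rw [ContinuousLinearMap.adjoint_adjoint] at h1
  refine HasSum.congr_fun (Complex.hasSum_ofReal.2 h1) fun i => ?_
  rw [ContinuousLinearMap.comp_apply, ContinuousLinearMap.adjoint_inner_right,
    inner_self_eq_norm_sq_to_K]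
  norm_cast

end Operators

/-! ### Matrices of operators on `ℓ²` -/

/-- The standard basis of `ℓ²`. -/
def deltaBasis : HilbertBasis ℕ ℂ EllTwo := HilbertBasis.ofRepr (LinearIsometryEquiv.refl ℂ EllTwo)

theorem deltaBasis_apply (n : ℕ) : deltaBasis n = delta n :=
  (deltaBasis.repr_symm_single n).symm

theorem inner_delta_left (n : ℕ) (x : EllTwo) : ⟪delta n, x⟫_ℂ = x n := by
  rw [← deltaBasis_apply, ← deltaBasis.repr_apply_apply]
  rfl

theorem norm_delta (n : ℕ) : ‖delta n‖ = 1 := by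
  rw [← deltaBasis_apply]
  exact deltaBasis.orthonormal.norm_eq_one n

theorem HasMatrix.adjoint {T : EllTwo →L[ℂ] EllTwo} {M : Matrix ℕ ℕ ℂ} (h : HasMatrix T M) :
    HasMatrix T.adjoint Mᴴ := fun j k => by
  rw [ContinuousLinearMap.adjoint_inner_right, ← inner_conj_symm, h k j]
  rfl

theorem HasMatrix.comp {T S : EllTwo →L[ℂ] EllTwo} {L M N : Matrix ℕ ℕ ℂ} (hT : HasMatrix T M)
    (hS : HasMatrix S N) (h : IsMatrixProduct L M N) : HasMatrix (T ∘L S) L := fun j k => by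
  have h1 := deltaBasis.hasSum_inner_mul_inner (T.adjoint (delta j)) (S (delta k))
  rw [ContinuousLinearMap.adjoint_inner_left] at h1
  refine h1.unique (HasSum.congr_fun (h j k) fun n => ?_)
  rw [deltaBasis_apply, ContinuousLinearMap.adjoint_inner_left, hT j n, hS n k]

/-- An operator on `ℓ²` with prescribed rows of summable norms. -/
theorem exists_operator_of_rows {v : ℕ → EllTwo} (hv : Summable fun k => ‖v k‖) :
    ∃ T : EllTwo →L[ℂ] EllTwo, IsTraceClass T ∧
      ∀ j x, ⟪delta j, T x⟫_ℂ = ⟪v j, x⟫_ℂ := by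
  let R : ℕ → EllTwo →L[ℂ] EllTwo := fun k => (innerSL ℂ (v k)).smulRight (delta k)
  have hR : Summable R := by
    refine Summable.of_norm_bounded hv fun k => ?_
    rw [ContinuousLinearMap.norm_smulRight_apply, norm_delta, mul_one, innerSL_apply_norm]
  have hx : ∀ x, HasSum (fun k => ⟪v k, x⟫_ℂ • delta k) ((∑' k, R k) x) := fun x =>
    hR.hasSum.mapL (ContinuousLinearMap.apply ℂ EllTwo x)
  refine ⟨∑' k, R k, isTraceClass_of_hasSum ?_ hx, fun j x => ?_⟩
  · simpa only [norm_delta, one_mul] using hv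
  · refine ((hx x).mapL (innerSL ℂ (delta j))).unique ?_
    have h1 : ∀ k, innerSL ℂ (delta j) (⟪v k, x⟫_ℂ • delta k) =
        if k = j then ⟪v j, x⟫_ℂ else 0 := fun k => by
      rw [innerSL_apply_apply, inner_smul_right, ← deltaBasis_apply, ← deltaBasis_apply,
        orthonormal_iff_ite.1 deltaBasis.orthonormal]
      split_ifs with h1 h2 h2
      · rw [h1, mul_one]
      · exact absurd h1.symm h2
      · exact absurd h2.symm h1
      · rw [mul_zero]
    simp only [h1]
    exact hasSum_ite_eq j _

/-! ### The sequence `c_k` -/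

theorem rowGram_self_nonneg (μ : Measure ℝ) (k : ℕ) : 0 ≤ rowGram μ k k :=
  tsum_nonneg fun _ => mul_self_nonneg _

theorem seqC_nonneg (μ : Measure ℝ) (k : ℕ) : 0 ≤ seqC μ k := Real.sqrt_nonneg _

theorem norm_matB (μ : Measure ℝ) (k n : ℕ) : ‖matB μ k n‖ = |(orthoPoly μ n).coeff k| := by
  rw [matB, Matrix.of_apply, Complex.norm_real, Real.norm_eq_abs]

theorem tendsto_mul_rpow_inv_of_le {c : ℕ → ℝ} (hc : ∀ k, 0 ≤ c k)
    (h : ∀ ε : ℝ, 0 < ε → ∃ K : ℝ, 0 < K ∧ ∀ r : ℝ, 0 < r → ∀ k, c k ≤ K * Real.exp (ε * r) / r ^ k) :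
    Tendsto (fun k : ℕ => (k : ℝ) * c k ^ (1 / (k : ℝ))) atTop (𝓝 0) := by
  rw [tendsto_order]
  refine ⟨fun a ha => .of_forall fun k => ha.trans_le
    (mul_nonneg k.cast_nonneg (Real.rpow_nonneg (hc k) _)), fun δ hδ => ?_⟩
  -- With r = k/ε, the minimiser of e^{εr}/r^k, the bound becomes K (eε/k)^k. The choice eε = δ/2
  -- leaves room for K^{1/k} → 1.
  obtain ⟨ε, hε⟩ : ∃ ε, ε = δ / 2 * Real.exp (-1) := ⟨_, rfl⟩
  have hε0 : 0 < ε := by rw [hε]; positivity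
  have hεδ : Real.exp 1 * ε = δ / 2 := by
    rw [hε, mul_left_comm, ← Real.exp_add]; simp
  obtain ⟨K, hK, hb⟩ := h ε hε0
  have hlim : Tendsto (fun k : ℕ => K ^ (1 / (k : ℝ)) * (δ / 2)) atTop (𝓝 (1 * (δ / 2))) := by
    refine Tendsto.mul_const _ ?_
    have := tendsto_one_div_atTop_nhds_zero_nat (𝕜 := ℝ)
    simpa using (tendsto_const_nhds (x := K)).rpow this (Or.inl hK.ne')
  filter_upwards [hlim.eventually_lt_const (show 1 * (δ / 2) < δ by linarith),
    eventually_gt_atTop 0] with k hk hk0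
  have hk1 : (0 : ℝ) < k := by exact_mod_cast hk0
  refine lt_of_le_of_lt ?_ hk
  have h1 := hb (k / ε) (by positivity) k
  have h2 : K * Real.exp (ε * (k / ε)) / (k / ε) ^ k = K * (δ / 2 / k) ^ k := by
    rw [mul_div_cancel₀ _ hε0.ne', ← hεδ, mul_div_assoc, div_eq_mul_inv (Real.exp k),
      ← inv_pow, inv_div, mul_div_assoc, mul_pow, ← Real.exp_nat_mul, mul_one]
  rw [h2] at h1
  have h3 := Real.rpow_le_rpow (hc k) h1 (show 0 ≤ 1 / (k : ℝ) by positivity)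
  rw [Real.mul_rpow hK.le (by positivity), one_div,
    Real.pow_rpow_inv_natCast (by positivity) hk0.ne'] at h3
  rw [one_div]
  refine (mul_le_mul_of_nonneg_left h3 hk1.le).trans_eq ?_
  field_simp

namespace IsMinimalTypeBound

variable {μ : Measure ℝ} {g : ℕ → ℝ} (h : IsMinimalTypeBound μ g)
include h

theorem seqC_sq (k : ℕ) : seqC μ k ^ 2 = rowGram μ k k := by
  rw [seqC, h.matA_eq, Complex.ofReal_re, Real.sq_sqrt (rowGram_self_nonneg μ k)]

theorem matA_self (k : ℕ) : matA μ k k = ((seqC μ k ^ 2 : ℝ) : ℂ) := by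
  rw [h.seqC_sq, h.matA_eq]

theorem hasSum_coeff_sq (k : ℕ) : HasSum (fun n => ‖matB μ k n‖ ^ 2) (seqC μ k ^ 2) := by
  rw [h.seqC_sq]
  refine HasSum.congr_fun (h.hasSum_rowGram k k) fun n => ?_
  rw [norm_matB, sq_abs, sq]

theorem hasSum_coeff_sq_Ici (k : ℕ) :
    HasSum (fun n : Set.Ici k => ‖matB μ k n‖ ^ 2) (seqC μ k ^ 2) := by
  refine (hasSum_subtype_iff_of_support_subset (f := fun n => ‖matB μ k n‖ ^ 2)
    fun n hn => ?_).2 (h.hasSum_coeff_sq k)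
  by_contra hlt
  refine hn ?_
  simp [norm_matB, h.coeff_eq_zero (not_le.1 hlt)]

/-- Cauchy's estimate squared and summed over n, since c_k² = ∑_n b_{k,n}² and g is square summable.
-/
theorem exists_seqC_le {ε : ℝ} (hε : 0 < ε) : ∃ K : ℝ, 0 < K ∧ ∀ r : ℝ, 0 < r → ∀ k,
    seqC μ k ≤ K * Real.exp (ε * r) / r ^ k := by
  obtain ⟨K, hK, hb⟩ := h.abs_coeff_le ε hε
  obtain ⟨G, hG⟩ : ∃ G, G = ∑' n, g n ^ 2 := ⟨_, rfl⟩
  have hG0 : 0 ≤ G := by rw [hG]; exact tsum_nonneg fun n => sq_nonneg _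
  refine ⟨K * √(G + 1), by positivity, fun r hr k => ?_⟩
  have h1 : seqC μ k ^ 2 ≤ (K * Real.exp (ε * r) / r ^ k) ^ 2 * G := by
    rw [hG, ← tsum_mul_left, ← (h.hasSum_coeff_sq k).tsum_eq]
    refine Summable.tsum_le_tsum (fun n => ?_) (h.hasSum_coeff_sq k).summable
      (h.summable.mul_left _)
    rw [norm_matB, ← mul_pow]
    refine pow_le_pow_left₀ (abs_nonneg _) ((hb r hr k n).trans_eq ?_) 2
    ring
  have h2 : (K * √(G + 1) * Real.exp (ε * r) / r ^ k) ^ 2 =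
      (K * Real.exp (ε * r) / r ^ k) ^ 2 * (G + 1) := by
    rw [← Real.sq_sqrt (show 0 ≤ G + 1 by positivity)]
    simp only [Real.sqrt_sq (Real.sqrt_nonneg _)]
    ring
  refine (pow_le_pow_iff_left₀ (Real.sqrt_nonneg _) (by positivity) two_ne_zero).1 ?_
  rw [h2]
  exact h1.trans (mul_le_mul_of_nonneg_left (by linarith) (sq_nonneg _))

theorem exists_seqC_le_geometric : ∃ K : ℝ, 0 < K ∧ ∀ k, seqC μ k ≤ K * (1 / 2) ^ k := by
  obtain ⟨K, hK, hb⟩ := h.exists_seqC_le one_pos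
  refine ⟨K * Real.exp (1 * 2), by positivity, fun k => (hb 2 two_pos k).trans_eq ?_⟩
  rw [one_div, inv_pow, div_eq_mul_inv]

theorem tendsto_mul_seqC_rpow :
    Tendsto (fun k : ℕ => (k : ℝ) * seqC μ k ^ (1 / (k : ℝ))) atTop (𝓝 0) :=
  tendsto_mul_rpow_inv_of_le (fun _ => Real.sqrt_nonneg _) fun _ hε => h.exists_seqC_le hε

/-! ### The operators -/

theorem memℓp_row (k : ℕ) : Memℓp (fun n => matB μ k n) 2 :=
  memℓp_gen (by simpa using (h.hasSum_coeff_sq k).summable)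

/-- The rows of the matrix `B` as elements of `ℓ²`. -/
def row (k : ℕ) : EllTwo := ⟨fun n => matB μ k n, h.memℓp_row k⟩

theorem norm_row (k : ℕ) : ‖h.row k‖ = seqC μ k := by
  have h1 : HasSum (fun n => ‖matB μ k n‖ ^ 2) (‖h.row k‖ ^ 2) := by
    have h2 := lp.hasSum_norm (p := 2) (by norm_num) (h.row k)
    simp only [ENNReal.toReal_ofNat, Real.rpow_two] at h2
    exact h2
  exact (pow_left_inj₀ (norm_nonneg _) (seqC_nonneg μ _) two_ne_zero).1
    (h1.unique (h.hasSum_coeff_sq k))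

theorem exists_traceClass_matB :
    ∃ B : EllTwo →L[ℂ] EllTwo, HasMatrix B (matB μ) ∧ IsTraceClass B := by
  obtain ⟨K, hK, hb⟩ := h.exists_seqC_le_geometric
  have hv : Summable fun k => ‖h.row k‖ := by
    refine Summable.of_nonneg_of_le (fun k => norm_nonneg _) (fun k => ?_)
      (summable_geometric_two.mul_left K)
    rw [h.norm_row]
    exact hb k
  obtain ⟨B, hB, hrow⟩ := exists_operator_of_rows hv
  refine ⟨B, fun j k => ?_, hB⟩
  -- The inner product with a row conjugates its entries, which is harmless because they are real.
  rw [hrow, ← inner_conj_symm, inner_delta_left]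
  change starRingEnd ℂ (matB μ j k) = matB μ j k
  simp [matB]

/-- The n-th column of B is the coefficient vector of P_n, so the squared Hilbert–Schmidt norm is
the sum found in `hasSum_rho0`. -/
theorem hasSum_norm_sq_of_hasMatrix {B : EllTwo →L[ℂ] EllTwo} (hB : HasMatrix B (matB μ)) :
    HasSum (fun n => ‖B (deltaBasis n)‖ ^ 2) (rho0 μ) := by
  refine HasSum.congr_fun h.hasSum_rho0 fun n => ?_
  refine (hasSum_norm_inner_sq deltaBasis (B (deltaBasis n))).unique ?_
  simp only [deltaBasis_apply, hB _ n, norm_matB, sq_abs]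
  refine hasSum_sum_of_ne_finset_zero fun k hk => ?_
  rw [h.coeff_eq_zero (by simpa using hk)]
  simp

/-- A = BB* and K = B*B are positive, so each is its own absolute value and a finite trace already
gives trace class. B itself is handled by nuclearity. -/
theorem exists_operators : ∃ A B K : EllTwo →L[ℂ] EllTwo,
    HasMatrix A (matA μ) ∧ HasMatrix B (matB μ) ∧ HasMatrix K (matK μ) ∧
    IsTraceClass A ∧ IsTraceClass B ∧ IsTraceClass K ∧
    HasTrace A (rho0 μ) ∧ HasTrace K (rho0 μ) := by
  obtain ⟨B, hB, hBt⟩ := h.exists_traceClass_matB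
  have h1 := h.hasSum_norm_sq_of_hasMatrix hB
  have hK : HasTrace (B.adjoint ∘L B) (rho0 μ) :=
    hasTrace_adjoint_comp_self deltaBasis (hasSum_norm_adjoint_sq deltaBasis deltaBasis h1)
  have hA : HasTrace (B ∘L B.adjoint) (rho0 μ) := by
    have := hasTrace_adjoint_comp_self deltaBasis (T := B.adjoint) (s := rho0 μ)
    rw [ContinuousLinearMap.adjoint_adjoint] at this
    exact this h1
  have hA0 : 0 ≤ B ∘L B.adjoint := by
    have := adjoint_comp_self_nonneg B.adjoint
    rwa [ContinuousLinearMap.adjoint_adjoint] at this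
  exact ⟨B ∘L B.adjoint, B, B.adjoint ∘L B, hB.comp hB.adjoint h.isMatrixProduct_matA, hB,
    hB.adjoint.comp hB h.isMatrixProduct_matK, isTraceClass_of_nonneg_of_hasTrace hA0 hA, hBt,
    isTraceClass_of_nonneg_of_hasTrace (adjoint_comp_self_nonneg B) hK, hA, hK⟩

/-! ### Summability of powers of the entries of `A` -/

/-- A is the Gram matrix of the rows of B, so this is Cauchy–Schwarz. -/
theorem norm_matA_le (j k : ℕ) : ‖matA μ j k‖ ≤ seqC μ j * seqC μ k := by
  have h2 : matA μ j k = ⟪h.row k, h.row j⟫_ℂ := by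
    refine (h.isMatrixProduct_matA j k).unique ?_
    refine HasSum.congr_fun (lp.hasSum_inner (h.row k) (h.row j)) fun n => ?_
    rw [RCLike.inner_apply]
    rfl
  rw [h2, mul_comm, ← h.norm_row, ← h.norm_row]
  exact norm_inner_le_norm _ _

theorem summable_norm_matA_rpow {ε : ℝ} (hε : 0 < ε) :
    Summable fun p : ℕ × ℕ => ‖matA μ p.1 p.2‖ ^ ε := by
  obtain ⟨K, hK, hb⟩ := h.exists_seqC_le_geometric
  have hgeo : Summable fun k : ℕ => (seqC μ k) ^ ε := by
    have hq : ((1 / 2 : ℝ) ^ ε) < 1 := Real.rpow_lt_one (by norm_num) (by norm_num) hε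
    refine Summable.of_nonneg_of_le (fun k => Real.rpow_nonneg (seqC_nonneg μ _) _) (fun k => ?_)
      ((summable_geometric_of_lt_one (Real.rpow_nonneg (by norm_num) _) hq).mul_left (K ^ ε))
    refine (Real.rpow_le_rpow (seqC_nonneg μ _) (hb k) hε.le).trans_eq ?_
    rw [Real.mul_rpow hK.le (by positivity), ← Real.rpow_natCast_mul (by norm_num),
      ← Real.rpow_mul_natCast (by norm_num), mul_comm ε]
  refine Summable.of_nonneg_of_le (fun p => Real.rpow_nonneg (norm_nonneg _) _) (fun p => ?_)
    (hgeo.mul_of_nonneg hgeo (fun k => Real.rpow_nonneg (seqC_nonneg μ _) _)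
      fun k => Real.rpow_nonneg (seqC_nonneg μ _) _)
  rw [← Real.mul_rpow (seqC_nonneg μ _) (seqC_nonneg μ _)]
  exact Real.rpow_le_rpow (norm_nonneg _) (h.norm_matA_le p.1 p.2) hε.le

end IsMinimalTypeBound

end MomentProblem

end

theorem proposition4p2 (μ : Measure ℝ) (hsupp : μ.support.Infinite)
    (hμ : MomentProblem.IsIndeterminate μ) :
    -- the kernel is well defined, and `A` is the matrix of its power series coefficients
    (∀ z : ℂ, Summable fun n => ‖MomentProblem.orthoEval μ n z‖ ^ 2) ∧
    (∀ z w : ℂ, HasSum (fun p : ℕ × ℕ => MomentProblem.matA μ p.1 p.2 * z ^ p.1 * w ^ p.2)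
      (MomentProblem.kernel μ z w)) ∧
    -- `ρ₀` is finite, and is the mean of the kernel on the unit circle
    IntervalIntegrable
      (fun t : ℝ => ∑' k, ‖MomentProblem.orthoEval μ k (Complex.exp (t * Complex.I))‖ ^ 2)
      volume 0 (2 * Real.pi) ∧
    (1 / (2 * Real.pi) : ℂ) * (∫ t in (0 : ℝ)..(2 * Real.pi),
      MomentProblem.kernel μ (Complex.exp (t * Complex.I)) (Complex.exp (-(t * Complex.I))))
        = (MomentProblem.rho0 μ : ℂ) ∧
    -- `K = B* B` and `A = B B*`
    MomentProblem.IsMatrixProduct (MomentProblem.matK μ)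
      (MomentProblem.matB μ)ᴴ (MomentProblem.matB μ) ∧
    MomentProblem.IsMatrixProduct (MomentProblem.matA μ)
      (MomentProblem.matB μ) (MomentProblem.matB μ)ᴴ ∧
    -- `A`, `B`, `K` are of trace class and `tr A = tr K = ρ₀`
    (∃ A B K : MomentProblem.EllTwo →L[ℂ] MomentProblem.EllTwo,
      MomentProblem.HasMatrix A (MomentProblem.matA μ) ∧
      MomentProblem.HasMatrix B (MomentProblem.matB μ) ∧
      MomentProblem.HasMatrix K (MomentProblem.matK μ) ∧
      MomentProblem.IsTraceClass A ∧ MomentProblem.IsTraceClass B ∧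
      MomentProblem.IsTraceClass K ∧
      MomentProblem.HasTrace A (MomentProblem.rho0 μ) ∧
      MomentProblem.HasTrace K (MomentProblem.rho0 μ)) ∧
    -- `c_k = √a_{k,k} = (∑_{n ≥ k} |b_{k,n}|²)^{1/2}`
    (∀ k, MomentProblem.matA μ k k = ((MomentProblem.seqC μ k ^ 2 : ℝ) : ℂ) ∧
      HasSum (fun n : Set.Ici k => ‖MomentProblem.matB μ k n‖ ^ 2)
        (MomentProblem.seqC μ k ^ 2)) ∧
    -- `k * c_k^{1/k} → 0`
    Tendsto (fun k : ℕ => (k : ℝ) * MomentProblem.seqC μ k ^ (1 / (k : ℝ))) atTop (𝓝 0) ∧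
    -- `∑_{j,k} |a_{j,k}|^ε < ∞` for every `ε > 0`
    (∀ ε : ℝ, 0 < ε → Summable fun p : ℕ × ℕ => ‖MomentProblem.matA μ p.1 p.2‖ ^ ε) := by
  obtain ⟨g, h⟩ := MomentProblem.exists_isMinimalTypeBound hsupp hμ
  refine ⟨h.summable_norm_sq_orthoEval, fun z w => ?_, h.intervalIntegrable_tsum_norm_sq,
    MomentProblem.circle_mean_kernel μ, h.isMatrixProduct_matK, h.isMatrixProduct_matA,
    h.exists_operators, fun k => ⟨h.matA_self k, h.hasSum_coeff_sq_Ici k⟩,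
    h.tendsto_mul_seqC_rpow, fun ε hε => h.summable_norm_matA_rpow hε⟩
  simpa only [h.matA_eq] using h.hasSum_rowGram_mul_pow z w
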